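/- Let $G$ be a finite simple undirected graph. For $X\subseteq V(G)$ let $J[X]$ be the set of all vertices lying on a chordless (induced) path between two (possibly equal) vertices of $X$; a set $C\subseteq V(G)$ is (monophonically) convex if $J[C]=C$, and $h(X)$ denotes the convex hull of $X$, i.e. the intersection of all convex sets containing $X$. Two sets $A,B\subseteq V(G)$ are half-space separable if there is a set $H\subseteq V(G)$ such that $H$ and $V(G)\setminus H$ are both convex, $A\subseteq H$ and $B\subseteq V(G)\setminus H$. They are linked if some edge of $G$ joins a vertex of $A$ to a vertex of $B$. Let $A/B=\{v\in V(G) : h(B\cup\{v\})\cap A\neq\emptyset\}$, let $\mathrm{mfs}(A,B)$ be the family of inclusion-wise minimal sets $X\subseteq V(G)\setminus(A\cup B)$ with $h(X)\cap A\neq\emptyset$ and $h(X)\cap B\neq\emptyset$, and put \[ \sigma(A,B)=h\Bigl(A/B\;\cup\bigcup_{X\in \mathrm{mfs}(A,B)}\ \bigcap_{x\in X}h(A\cup\{x\})\Bigr). \] With $A_0=A$, $B_0=B$, $A_{i+1}=\sigma(A_i,B_i)$, $B_{i+1}=\sigma(B_i,A_i)$, the saturation of $A$ with respect to $B$ is $S(A,B)=\bigcup_{i\ge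 0}\sigma(A_i,B_i)$; the sets $A,B$ are saturated if $A=S(A,B)$ and $B=S(B,A)$. Theorem. There is an algorithm which, given a connected graph $G$ and two disjoint, linked and saturated sets $A,B\subseteq V(G)$, decides in time polynomial in the size of $G$ whether $A$ and $B$ are half-space separable. Here an algorithm is a program of a unit-cost random access machine whose arithmetic operations are addition and truncated subtraction of natural numbers. The vertex set is $\{0,\dots,n-1\}$, and the input consists of $n$, the adjacency matrix of $G$ and the indicator vectors of $A$ and $B$. One fixed program and one fixed polynomial $p$ serve all inputs that satisfy the hypotheses: the program halts after at most $p(n)$ steps, with output $1$ if $A$ and $B$ are half-space separable and output $0$ otherwise. -/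

import Mathlib

/-! ### Monophonic convexity -/

namespace Monophonic

variable {V : Type*} (G : SimpleGraph V)

/-- The monophonic closed interval `J[u, v]`: the vertices lying on a chordless (that is, induced)
path from `u` to `v`. -/
def interval (u v : V) : Set V :=
  {w | ∃ p : G.Walk u v, p.IsPath ∧ p.IsChordless ∧ w ∈ p.support}

/-- `J[X]`, the union of the intervals `J[u, v]` over `u, v ∈ X`. -/
def intervalSet (X : Set V) : Set V :=
  ⋃ u ∈ X, ⋃ v ∈ X, interval G u v

/-- `C` is monophonically convex. -/
def IsConvex (C : Set V) : Prop :=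
  intervalSet G C = C

/-- The convex hull: the intersection of all convex sets containing `X`. -/
def hull (X : Set V) : Set V :=
  ⋂₀ {C | IsConvex G C ∧ X ⊆ C}

/-- A half-space is a convex set whose complement is convex. -/
def IsHalfSpace (H : Set V) : Prop :=
  IsConvex G H ∧ IsConvex G Hᶜ

/-- `A` and `B` are half-space separable. -/
def Separable (A B : Set V) : Prop :=
  ∃ H : Set V, IsHalfSpace G H ∧ A ⊆ H ∧ B ⊆ Hᶜ

/-- `A` and `B` are linked: some edge joins a vertex of `A` to a vertex of `B`. -/
def Linked (A B : Set V) : Prop :=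
  ∃ a ∈ A, ∃ b ∈ B, G.Adj a b

/-- The shadow `A / B` of `A` with respect to `B`. -/
def shadow (A B : Set V) : Set V :=
  {v | (hull G (B ∪ {v}) ∩ A).Nonempty}

/-- `X` is a forbidden set of `A` and `B`. -/
def IsForbidden (A B X : Set V) : Prop :=
  X ⊆ (A ∪ B)ᶜ ∧ (hull G X ∩ A).Nonempty ∧ (hull G X ∩ B).Nonempty

/-- The family of inclusion-wise minimal forbidden sets of `A` and `B`. -/
def mfs (A B : Set V) : Set (Set V) :=
  {X | Minimal (IsForbidden G A B) X}

/-- The pre-saturation `σ(A, B)` of `A` with respect to `B`. -/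
def preSaturation (A B : Set V) : Set V :=
  hull G (shadow G A B ∪ ⋃ X ∈ mfs G A B, ⋂ x ∈ X, hull G (A ∪ {x}))

/-- The pairs `(Aᵢ, Bᵢ)` obtained from `(A, B)` by iterating the pre-saturation on both sides
simultaneously. -/
def saturationSeq (A B : Set V) : ℕ → Set V × Set V
  | 0 => (A, B)
  | i + 1 =>
    (preSaturation G (saturationSeq A B i).1 (saturationSeq A B i).2,
      preSaturation G (saturationSeq A B i).2 (saturationSeq A B i).1)

/-- The saturation `S(A, B) = ⋃ᵢ σ(Aᵢ, Bᵢ)` of `A` with respect to `B`. -/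
def saturation (A B : Set V) : Set V :=
  ⋃ i : ℕ, preSaturation G (saturationSeq G A B i).1 (saturationSeq G A B i).2

/-- `A` and `B` are saturated. -/
def Saturated (A B : Set V) : Prop :=
  A = saturation G A B ∧ B = saturation G B A

end Monophonic

/-! ### Random access machines

Unit-cost random access machines over the natural numbers whose arithmetic operations are addition
and truncated subtraction (no multiplication), with structured control flow. The program is a fixed
finite object; every elementary instruction, every test and every unfolding of a control structure
takes one step. -/

namespace RAM

/-- Programs. Registers and literal constants are given by natural numbers fixed in the program. -/
inductive Program : Type
  | skip : Program
  /-- `const r c`: register `r` gets the value `c`. -/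
  | const (r c : ℕ) : Program
  /-- `add r a b`: register `r` gets the sum of registers `a` and `b`. -/
  | add (r a b : ℕ) : Program
  /-- `sub r a b`: register `r` gets the truncated difference of registers `a` and `b`. -/
  | sub (r a b : ℕ) : Program
  /-- `load r a`: register `r` gets the content of the memory cell whose address is in
  register `a`. -/
  | load (r a : ℕ) : Program
  /-- `store a r`: the memory cell whose address is in register `a` gets the content of
  register `r`. -/
  | store (a r : ℕ) : Program
  | seq (P Q : Program) : Program
  /-- `ite r P Q`: run `P` if register `r` is nonzero, and `Q` otherwise. -/
  | ite (r : ℕ) (P Q : Program) : Program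
  /-- `loop r P`: repeat `P` while register `r` is nonzero, testing before each round. -/
  | loop (r : ℕ) (P : Program) : Program

/-- The contents of the registers and of the memory cells. -/
structure State : Type where
  reg : ℕ → ℕ
  mem : ℕ → ℕ

/-- Set register `r` to `x`. -/
def State.setReg (s : State) (r x : ℕ) : State :=
  { s with reg := Function.update s.reg r x }

/-- Set memory cell `a` to `x`. -/
def State.setMem (s : State) (a x : ℕ) : State :=
  { s with mem := Function.update s.mem a x }

/-- A configuration: the subprograms that remain to be executed, in this order, and the state.
The machine has halted when nothing remains. -/
abbrev Config : Type := List Program × State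

/-- One step of the machine. -/
def step : Config → Config
  | ([], s) => ([], s)
  | (.skip :: k, s) => (k, s)
  | (.const r c :: k, s) => (k, s.setReg r c)
  | (.add r a b :: k, s) => (k, s.setReg r (s.reg a + s.reg b))
  | (.sub r a b :: k, s) => (k, s.setReg r (s.reg a - s.reg b))
  | (.load r a :: k, s) => (k, s.setReg r (s.mem (s.reg a)))
  | (.store a r :: k, s) => (k, s.setMem (s.reg a) (s.reg r))
  | (.seq P Q :: k, s) => (P :: Q :: k, s)
  | (.ite r P Q :: k, s) => ((if s.reg r ≠ 0 then P else Q) :: k, s)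
  | (.loop r P :: k, s) => (if s.reg r ≠ 0 then P :: .loop r P :: k else k, s)

/-- The initial state: all registers are zero, memory cell `i` holds the `i`-th entry of the input,
and all cells beyond the input are zero. -/
def initState (input : List ℕ) : State where
  reg := fun _ => 0
  mem := fun i => input.getD i 0

/-- On the given input, `P` halts after at most `t` steps with the value `y` in register `0`. -/
def OutputsWithin (P : Program) (input : List ℕ) (t y : ℕ) : Prop :=
  ∃ k ≤ t, ∃ s : State, step^[k] ([P], initState input) = ([], s) ∧ s.reg 0 = y

open Classical in
/-- A truth value as `0` or `1`. -/
noncomputable def bit (p : Prop) : ℕ := if p then 1 else 0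

/-- The input word for a graph on `n` vertices with two vertex sets: the number `n`, the adjacency
matrix row by row, and the indicator vectors of the two sets. -/
noncomputable def encode {n : ℕ} (G : SimpleGraph (Fin n)) (A B : Set (Fin n)) : List ℕ :=
  [n] ++ List.ofFn (fun k : Fin (n * n) => bit (G.Adj k.divNat k.modNat)) ++
    List.ofFn (fun v : Fin n => bit (v ∈ A)) ++ List.ofFn (fun v : Fin n => bit (v ∈ B))

end RAM

/-! In a connected graph, a vertex set is a half-space exactly when its own inner boundary and that
of its complement are cliques (`isHalfSpace_iff`). Let `H` separate `A` from `B`, and let `ab` be an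
edge with `a ∈ A` and `b ∈ B`. Then `a` and `b` lie in the two boundary cliques, so an edge `uv`
with `u ∈ H` and `v ∉ H` has `u` in the closed neighbourhood of `a` and `v` in that of `b`. For all
other edges this is an implication from `u ∈ H` to `v ∈ H`.

It remains to express that two non-adjacent neighbours of `a` are not both in the boundary of `H`.
That `u` is in the boundary because of its neighbour `v` looks like a condition on two vertices, but
one literal suffices. If `u` is adjacent to `b`, the literal is `u ∈ H`. Otherwise it is `v ∉ H`:
here `u ∉ H` would put `u` and `b` into the boundary clique of the complement and make them
adjacent. Hence separability is an instance of 2-SAT (`separable_iff`), which is unsatisfiable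
exactly when some literal and its negation imply each other (`exists_forall_isTrue_iff`).

The program tabulates the implications between the `2n` literals, closes the table by Warshall's
algorithm (`forBelow_composeStmt_run`) and looks for such a literal (`separationStmt_run`). Running
time is settled once for a small language of bounded loops that writes nothing but ones into memory:
all values, and so all numbers of rounds, stay polynomial in `n` (`exists_outputsWithin`). -/

/-! ### Compiling bounded loops to random access machines -/

namespace RAM

/-- Executing `P` from `s` leads to `s'` in exactly `t` steps, whatever remains to be executed. -/
def Runs (P : Program) (s s' : State) (t : ℕ) : Prop :=
  ∀ k, step^[t] (P :: k, s) = (k, s')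

section Runs

variable {P Q : Program} {s s₁ s₂ : State} {r t₁ t₂ : ℕ}

theorem Runs.seq (h₁ : Runs P s s₁ t₁) (h₂ : Runs Q s₁ s₂ t₂) :
    Runs (.seq P Q) s s₂ (t₂ + (t₁ + 1)) := by
  intro k
  rw [Function.iterate_add_apply, Function.iterate_succ_apply]
  simp only [step]
  rw [h₁, h₂]

theorem Runs.ite_pos (h : s.reg r ≠ 0) (h₁ : Runs P s s₁ t₁) :
    Runs (.ite r P Q) s s₁ (t₁ + 1) := by
  intro k
  rw [Function.iterate_succ_apply]
  simp only [step]
  rw [if_pos h, h₁]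

theorem Runs.ite_neg (h : s.reg r = 0) (h₁ : Runs Q s s₁ t₁) :
    Runs (.ite r P Q) s s₁ (t₁ + 1) := by
  intro k
  rw [Function.iterate_succ_apply]
  simp only [step]
  rw [if_neg (not_not.2 h), h₁]

theorem Runs.loop_zero (h : s.reg r = 0) : Runs (.loop r P) s s 1 := by
  intro k
  simp [step, h]

theorem Runs.loop_succ (h : s.reg r ≠ 0) (h₁ : Runs P s s₁ t₁)
    (h₂ : Runs (.loop r P) s₁ s₂ t₂) : Runs (.loop r P) s s₂ (t₂ + (t₁ + 1)) := by
  intro k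
  rw [Function.iterate_add_apply, Function.iterate_succ_apply]
  simp only [step]
  rw [if_pos h, h₁, h₂]

theorem runs_skip (s : State) : Runs .skip s s 1 := fun _ => rfl

theorem runs_const (s : State) (r c : ℕ) : Runs (.const r c) s (s.setReg r c) 1 := fun _ => rfl

theorem runs_add (s : State) (r a b : ℕ) :
    Runs (.add r a b) s (s.setReg r (s.reg a + s.reg b)) 1 := fun _ => rfl

theorem runs_sub (s : State) (r a b : ℕ) :
    Runs (.sub r a b) s (s.setReg r (s.reg a - s.reg b)) 1 := fun _ => rfl

theorem runs_load (s : State) (r a : ℕ) :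
    Runs (.load r a) s (s.setReg r (s.mem (s.reg a))) 1 := fun _ => rfl

theorem runs_store (s : State) (a r : ℕ) :
    Runs (.store a r) s (s.setMem (s.reg a) (s.reg r)) 1 := fun _ => rfl

end Runs

@[simp] theorem State.setReg_mem (s : State) (r x : ℕ) : (s.setReg r x).mem = s.mem := rfl

@[simp] theorem State.setMem_reg (s : State) (r x : ℕ) : (s.setMem r x).reg = s.reg := rfl

@[simp] theorem State.setMem_mem (s : State) (a x : ℕ) :
    (s.setMem a x).mem = Function.update s.mem a x := rfl

@[simp] theorem State.setReg_reg_self (s : State) (r x : ℕ) : (s.setReg r x).reg r = x := by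
  simp [State.setReg]

theorem State.setReg_reg_of_ne (s : State) {r i : ℕ} (x : ℕ) (h : i ≠ r) :
    (s.setReg r x).reg i = s.reg i := by
  simp [State.setReg, h]

/-! ### Expressions: evaluation, compilation and cost. -/

/-- Arithmetic expressions over a list of variables and the memory. -/
inductive Expr : Type
  | var (i : ℕ) : Expr
  | lit (c : ℕ) : Expr
  | add (e f : Expr) : Expr
  | sub (e f : Expr) : Expr
  | mul (e f : Expr) : Expr
  | load (e : Expr) : Expr

/-- The value of an expression. -/
def Expr.eval (ρ : List ℕ) (m : ℕ → ℕ) : Expr → ℕ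
  | var i => ρ.getD i 0
  | lit c => c
  | add e f => e.eval ρ m + f.eval ρ m
  | sub e f => e.eval ρ m - f.eval ρ m
  | mul e f => e.eval ρ m * f.eval ρ m
  | load e => m (e.eval ρ m)

/-- A program that multiplies registers `d` and `d + 1` into register `d`. -/
def mulProgram (d : ℕ) : Program :=
  .seq (.const (d + 2) 0) (.seq (.const (d + 3) 1) (.seq
    (.loop d (.seq (.add (d + 2) (d + 2) (d + 1)) (.sub d d (d + 3)))) (.add d d (d + 2))))

/-- A program that puts the value of an expression into register `d`, when the `l` variables are
in the first `l` registers. It changes no register below `d`. -/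
def Expr.compile (l : ℕ) : Expr → ℕ → Program
  | var i, d => if i < l then .seq (.const d 0) (.add d d i) else .const d 0
  | lit c, d => .const d c
  | add e f, d => .seq (e.compile l d) (.seq (f.compile l (d + 1)) (.add d d (d + 1)))
  | sub e f, d => .seq (e.compile l d) (.seq (f.compile l (d + 1)) (.sub d d (d + 1)))
  | mul e f, d => .seq (e.compile l d) (.seq (f.compile l (d + 1)) (mulProgram d))
  | load e, d => .seq (e.compile l d) (.load d d)

/-- Repeated addition: register `d` counts down, `d + 2` accumulates, `d + 3` holds the decrement. A
round costs four steps, so multiplication is polynomial only as long as the first factor is. -/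
theorem runs_mulLoop (d y x : ℕ) : ∀ (z : ℕ) (s : State), s.reg d = x → s.reg (d + 1) = y →
    s.reg (d + 2) = z → s.reg (d + 3) = 1 →
    ∃ s', Runs (.loop d (.seq (.add (d + 2) (d + 2) (d + 1)) (.sub d d (d + 3)))) s s'
        (4 * x + 1) ∧
      s'.reg d = 0 ∧ s'.reg (d + 2) = z + x * y ∧ (∀ i < d, s'.reg i = s.reg i) ∧
      s'.mem = s.mem := by
  induction x with
  | zero =>
    exact fun z s h _ h2 _ => ⟨s, Runs.loop_zero h, h, by simpa using h2, fun _ _ => rfl, rfl⟩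
  | succ x ih =>
    intro z s h h1 h2 h3
    have hb := (runs_add s (d + 2) (d + 2) (d + 1)).seq (runs_sub _ d d (d + 3))
    rw [State.setReg_reg_of_ne _ _ (by lia), State.setReg_reg_of_ne _ _ (by lia), h, h1, h2, h3,
      Nat.add_sub_cancel] at hb
    obtain ⟨s', hs', h0', hz', hlt, hm⟩ := ih (z + y) ((s.setReg (d + 2) (z + y)).setReg d x)
      (by simp) (by simp [State.setReg, h1]) (by simp [State.setReg])
      (by simp [State.setReg, h3])
    refine ⟨s', ?_, h0', by rw [hz']; ring, fun i hi => ?_, hm⟩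
    · have := Runs.loop_succ (by rw [h]; simp) hb hs'
      convert this using 1
      lia
    · rw [hlt i hi, State.setReg_reg_of_ne _ _ (by lia), State.setReg_reg_of_ne _ _ (by lia)]

theorem runs_mulProgram (d : ℕ) (s : State) :
    ∃ s' t, t ≤ 4 * s.reg d + 8 ∧ Runs (mulProgram d) s s' t ∧
      s'.reg d = s.reg d * s.reg (d + 1) ∧ (∀ i < d, s'.reg i = s.reg i) ∧ s'.mem = s.mem := by
  obtain ⟨s', hs', h0, hz, hlt, hm⟩ := runs_mulLoop d (s.reg (d + 1)) (s.reg d) 0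
    ((s.setReg (d + 2) 0).setReg (d + 3) 1)
    (by simp [State.setReg]) (by simp [State.setReg]) (by simp [State.setReg])
    (by simp [State.setReg])
  refine ⟨_, _, ?_, (runs_const _ _ _).seq ((runs_const _ _ _).seq (hs'.seq (runs_add _ _ _ _))),
    ?_, fun i hi => ?_, ?_⟩
  · simp
    lia
  · simp [h0, hz]
  · rw [State.setReg_reg_of_ne _ _ (by lia), hlt i hi, State.setReg_reg_of_ne _ _ (by lia),
      State.setReg_reg_of_ne _ _ (by lia)]
  · simp [hm]

/-- The first registers of `s` hold the entries of `ρ`. -/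
def Holds (s : State) (ρ : List ℕ) : Prop :=
  ∀ (i : ℕ) (h : i < ρ.length), s.reg i = ρ[i]

theorem Holds.congr {s s' : State} {ρ : List ℕ} (h : Holds s ρ)
    (h' : ∀ i < ρ.length, s'.reg i = s.reg i) : Holds s' ρ :=
  fun i hi => (h' i hi).trans (h i hi)

/-- All variables and all memory cells are at most `X`. -/
def Bounded (ρ : List ℕ) (m : ℕ → ℕ) (X : ℕ) : Prop :=
  (∀ x ∈ ρ, x ≤ X) ∧ ∀ a, m a ≤ X

/-- Bounds the number of rounds, both of multiplication loops and of the loops of statements. -/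
theorem Expr.exists_eval_le (e : Expr) : ∃ p : Polynomial ℕ, ∀ ρ m X, Bounded ρ m X →
    e.eval ρ m ≤ p.eval X := by
  induction e with
  | var i =>
    refine ⟨.X, fun ρ m X h => ?_⟩
    rw [Polynomial.eval_X, Expr.eval, List.getD_eq_getElem?_getD]
    by_cases hi : i < ρ.length
    · simpa [hi] using h.1 _ (List.getElem_mem hi)
    · simp [not_lt.1 hi]
  | lit c => exact ⟨.C c, fun ρ m X _ => by simp [Expr.eval]⟩
  | add e f he hf =>
    obtain ⟨p, hp⟩ := he
    obtain ⟨q, hq⟩ := hf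
    exact ⟨p + q, fun ρ m X h => by
      simpa [Expr.eval] using add_le_add (hp ρ m X h) (hq ρ m X h)⟩
  | sub e f he hf =>
    obtain ⟨p, hp⟩ := he
    exact ⟨p, fun ρ m X h => (Nat.sub_le _ _).trans (hp ρ m X h)⟩
  | mul e f he hf =>
    obtain ⟨p, hp⟩ := he
    obtain ⟨q, hq⟩ := hf
    exact ⟨p * q, fun ρ m X h => by
      simpa [Expr.eval] using Nat.mul_le_mul (hp ρ m X h) (hq ρ m X h)⟩
  | load e he => exact ⟨.X, fun ρ m X h => by simpa [Expr.eval] using h.2 _⟩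

theorem Expr.exists_runs_compile (e : Expr) : ∃ p : Polynomial ℕ, ∀ ρ X d (s : State),
    ρ.length ≤ d → Holds s ρ → Bounded ρ s.mem X →
    ∃ s' t, t ≤ p.eval X ∧ Runs (e.compile ρ.length d) s s' t ∧ (∀ i < d, s'.reg i = s.reg i) ∧
      s'.mem = s.mem ∧ s'.reg d = e.eval ρ s.mem := by
  -- The binary operations differ only in the last program `P d` and its cost `r`. The value of `f`
  -- is computed in register `d + 1`, which leaves register `d` intact. `hP` may use that register
  -- `d` holds the value of `e`, because the cost of a multiplication depends on it.
  have binary (P : ℕ → Program) (op : ℕ → ℕ → ℕ) (e f : Expr) (r : Polynomial ℕ)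
      (hP : ∀ ρ X d (s : State), s.reg d = e.eval ρ s.mem → Bounded ρ s.mem X →
        ∃ s' t, t ≤ r.eval X ∧ Runs (P d) s s' t ∧
        s'.reg d = op (s.reg d) (s.reg (d + 1)) ∧ (∀ i < d, s'.reg i = s.reg i) ∧ s'.mem = s.mem)
      (he : ∃ p : Polynomial ℕ, ∀ ρ X d (s : State),
        ρ.length ≤ d → Holds s ρ → Bounded ρ s.mem X →
        ∃ s' t, t ≤ p.eval X ∧ Runs (e.compile ρ.length d) s s' t ∧
          (∀ i < d, s'.reg i = s.reg i) ∧ s'.mem = s.mem ∧ s'.reg d = e.eval ρ s.mem)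
      (hf : ∃ p : Polynomial ℕ, ∀ ρ X d (s : State),
        ρ.length ≤ d → Holds s ρ → Bounded ρ s.mem X →
        ∃ s' t, t ≤ p.eval X ∧ Runs (f.compile ρ.length d) s s' t ∧
          (∀ i < d, s'.reg i = s.reg i) ∧ s'.mem = s.mem ∧ s'.reg d = f.eval ρ s.mem) :
      ∃ p : Polynomial ℕ, ∀ ρ X d (s : State), ρ.length ≤ d → Holds s ρ → Bounded ρ s.mem X →
        ∃ s' t, t ≤ p.eval X ∧
          Runs (.seq (e.compile ρ.length d) (.seq (f.compile ρ.length (d + 1)) (P d))) s s' t ∧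
          (∀ i < d, s'.reg i = s.reg i) ∧ s'.mem = s.mem ∧
          s'.reg d = op (e.eval ρ s.mem) (f.eval ρ s.mem) := by
    obtain ⟨p, hp⟩ := he
    obtain ⟨q, hq⟩ := hf
    refine ⟨p + q + r + 2, fun ρ X d s hd hs hX => ?_⟩
    obtain ⟨s₁, t₁, ht₁, hr₁, hlt₁, hm₁, he₁⟩ := hp ρ X d s hd hs hX
    obtain ⟨s₂, t₂, ht₂, hr₂, hlt₂, hm₂, he₂⟩ := hq ρ X (d + 1) s₁ (by lia)
      (hs.congr fun i hi => hlt₁ i (by lia)) (by rwa [hm₁])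
    have hd₂ : s₂.reg d = e.eval ρ s.mem := by rw [hlt₂ d (by lia), he₁]
    obtain ⟨s₃, t₃, ht₃, hr₃, he₃, hlt₃, hm₃⟩ := hP ρ X d s₂ (by rw [hd₂, hm₂, hm₁])
      (by rwa [hm₂, hm₁])
    refine ⟨s₃, _, ?_, hr₁.seq (hr₂.seq hr₃), fun i hi => ?_, by rw [hm₃, hm₂, hm₁], ?_⟩
    · simp only [Polynomial.eval_add, Polynomial.eval_ofNat]
      lia
    · rw [hlt₃ i hi, hlt₂ i (by lia), hlt₁ i hi]
    · rw [he₃, hd₂, he₂, hm₁]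
  induction e with
  | var i =>
    refine ⟨3, fun ρ X d s hd hs _ => ?_⟩
    by_cases hi : i < ρ.length
    · refine ⟨_, _, ?_, by
        rw [Expr.compile, if_pos hi]
        exact (runs_const _ _ _).seq (runs_add _ _ _ _), fun j hj => ?_, by simp, ?_⟩
      · simp
      · rw [State.setReg_reg_of_ne _ _ (by lia), State.setReg_reg_of_ne _ _ (by lia)]
      · have : i ≠ d := by lia
        simp [State.setReg_reg_of_ne _ _ this, Expr.eval, hi, hs i hi]
    · refine ⟨_, _, ?_, by rw [Expr.compile, if_neg hi]; exact runs_const _ _ _,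
        fun j hj => State.setReg_reg_of_ne _ _ (by lia), by simp, ?_⟩
      · simp
      · simp [Expr.eval, not_lt.1 hi]
  | lit c =>
    exact ⟨1, fun ρ X d s hd hs _ => ⟨_, _, by simp, runs_const _ _ _,
      fun j hj => State.setReg_reg_of_ne _ _ (by lia), by simp, by simp [Expr.eval]⟩⟩
  | add e f he hf =>
    exact binary (fun d => .add d d (d + 1)) (· + ·) e f 1 (fun ρ X d s _ _ =>
      ⟨_, _, by simp, runs_add _ _ _ _, by simp,
        fun j hj => State.setReg_reg_of_ne _ _ (by lia), by simp⟩) he hf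
  | sub e f he hf =>
    exact binary (fun d => .sub d d (d + 1)) (· - ·) e f 1 (fun ρ X d s _ _ =>
      ⟨_, _, by simp, runs_sub _ _ _ _, by simp,
        fun j hj => State.setReg_reg_of_ne _ _ (by lia), by simp⟩) he hf
  | mul e f he hf =>
    obtain ⟨q, hq⟩ := e.exists_eval_le
    refine binary mulProgram (· * ·) e f (4 * q + 8) (fun ρ X d s hs hX => ?_) he hf
    obtain ⟨s', t, ht, h⟩ := runs_mulProgram d s
    refine ⟨s', t, ht.trans ?_, h⟩
    have := hq _ _ _ hX
    simp only [Polynomial.eval_add, Polynomial.eval_mul, Polynomial.eval_ofNat]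
    lia
  | load e he =>
    obtain ⟨p, hp⟩ := he
    refine ⟨p + 2, fun ρ X d s hd hs hX => ?_⟩
    obtain ⟨s₁, t₁, ht₁, hr₁, hlt₁, hm₁, he₁⟩ := hp ρ X d s hd hs hX
    refine ⟨_, _, ?_, hr₁.seq (runs_load _ _ _), fun i hi => ?_, by simpa, ?_⟩
    · simp only [Polynomial.eval_add, Polynomial.eval_ofNat]
      lia
    · rw [State.setReg_reg_of_ne _ _ (by lia), hlt₁ i hi]
    · simp [he₁, hm₁, Expr.eval]

/-! ### Statements with bounded loops: semantics, compilation and cost. -/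

/-- Statements: conditionally writing a one into a memory cell, and bounded loops. -/
inductive Stmt : Type
  /-- `put c e`: if `c` is nonzero, then the memory cell `e` gets the content `1`. -/
  | put (c e : Expr) : Stmt
  | seq (S T : Stmt) : Stmt
  /-- `forBelow e S`: execute `S` for all values below `e` of a new last variable. -/
  | forBelow (e : Expr) (S : Stmt) : Stmt

/-- Apply `f (N - 1)`, …, `f 0` in this order. -/
def iterateDown (f : ℕ → (ℕ → ℕ) → ℕ → ℕ) : ℕ → (ℕ → ℕ) → ℕ → ℕ
  | 0, m => m
  | N + 1, m => iterateDown f N (f N m)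

/-- The memory after the execution of a statement. -/
def Stmt.run : Stmt → List ℕ → (ℕ → ℕ) → ℕ → ℕ
  | put c e, ρ, m => if c.eval ρ m ≠ 0 then Function.update m (e.eval ρ m) 1 else m
  | seq S T, ρ, m => T.run ρ (S.run ρ m)
  | forBelow e S, ρ, m => iterateDown (fun i => S.run (ρ ++ [i])) (e.eval ρ m) m

/-- The program of a statement whose `d` variables are in the first `d` registers. -/
def Stmt.compile : Stmt → ℕ → Program
  | put c e, d => .seq (c.compile d d)
      (.ite d (.seq (e.compile d d) (.seq (.const (d + 1) 1) (.store d (d + 1)))) .skip)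
  | seq S T, d => .seq (S.compile d) (T.compile d)
  | forBelow e S, d => .seq (e.compile d d)
      (.loop d (.seq (.const (d + 1) 1) (.seq (.sub d d (d + 1)) (S.compile (d + 1)))))

/-- Only ones are written, so a bound on the memory survives any number of rounds unchanged. Without
this, nested loops could make values grow beyond every polynomial. -/
theorem Stmt.run_le (S : Stmt) (X : ℕ) (hX : 1 ≤ X) : ∀ ρ m, (∀ a, m a ≤ X) →
    ∀ a, S.run ρ m a ≤ X := by
  induction S with
  | put c e =>
    intro ρ m h a
    simp only [Stmt.run]
    split_ifs
    · by_cases ha : a = e.eval ρ m <;> simp [ha, hX, h]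
    · exact h a
  | seq S T hS hT => exact fun ρ m h => hT ρ _ (hS ρ m h)
  | forBelow e S hS =>
    intro ρ m
    simp only [Stmt.run]
    generalize e.eval ρ m = N
    induction N generalizing m with
    | zero => exact fun h => h
    | succ N ih => exact fun h => ih _ (hS _ m h)

theorem Stmt.exists_runs_compile (S : Stmt) : ∃ p : Polynomial ℕ, ∀ ρ X (s : State), 1 ≤ X →
    Holds s ρ → Bounded ρ s.mem X →
    ∃ s' t, t ≤ p.eval X ∧ Runs (S.compile ρ.length) s s' t ∧
      (∀ i < ρ.length, s'.reg i = s.reg i) ∧ s'.mem = S.run ρ s.mem := by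
  induction S with
  | put c e =>
    obtain ⟨p, hp⟩ := c.exists_runs_compile
    obtain ⟨q, hq⟩ := e.exists_runs_compile
    refine ⟨p + q + 6, fun ρ X s _ hs hX => ?_⟩
    obtain ⟨s₁, t₁, ht₁, hr₁, hlt₁, hm₁, he₁⟩ := hp ρ X _ s le_rfl hs hX
    by_cases hc : c.eval ρ s.mem = 0
    · refine ⟨s₁, _, ?_, hr₁.seq (Runs.ite_neg (he₁.trans hc) (runs_skip _)), hlt₁, ?_⟩
      · simp only [Polynomial.eval_add, Polynomial.eval_ofNat]
        lia
      · simp [Stmt.run, hc, hm₁]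
    · obtain ⟨s₂, t₂, ht₂, hr₂, hlt₂, hm₂, he₂⟩ := hq ρ X _ s₁ le_rfl (hs.congr hlt₁)
        (by rwa [hm₁])
      refine ⟨_, _, ?_, hr₁.seq (Runs.ite_pos (by rwa [he₁])
        (hr₂.seq ((runs_const _ _ _).seq (runs_store _ _ _)))), fun i hi => ?_, ?_⟩
      · simp only [Polynomial.eval_add, Polynomial.eval_ofNat]
        lia
      · rw [State.setMem_reg, State.setReg_reg_of_ne _ _ (by lia), hlt₂ i hi, hlt₁ i hi]
      · rw [State.setMem_mem, State.setReg_reg_self, State.setReg_reg_of_ne _ _ (by lia), he₂,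
          State.setReg_mem, hm₂, hm₁, Stmt.run, if_pos hc]
  | seq S T hS hT =>
    obtain ⟨p, hp⟩ := hS
    obtain ⟨q, hq⟩ := hT
    refine ⟨p + q + 1, fun ρ X s h1 hs hX => ?_⟩
    obtain ⟨s₁, t₁, ht₁, hr₁, hlt₁, hm₁⟩ := hp ρ X s h1 hs hX
    obtain ⟨s₂, t₂, ht₂, hr₂, hlt₂, hm₂⟩ := hq ρ X s₁ h1 (hs.congr hlt₁)
      ⟨hX.1, hm₁ ▸ S.run_le X h1 ρ s.mem hX.2⟩
    refine ⟨s₂, _, ?_, hr₁.seq hr₂, fun i hi => (hlt₂ i hi).trans (hlt₁ i hi), ?_⟩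
    · simp only [Polynomial.eval_add, Polynomial.eval_one]
      lia
    · rw [hm₂, hm₁, Stmt.run]
  | forBelow e S hS =>
    obtain ⟨p, hp⟩ := e.exists_runs_compile
    obtain ⟨q, hq⟩ := e.exists_eval_le
    obtain ⟨r, hr⟩ := hS
    -- At most `q` rounds. The body sees the loop variable as one more value, which is below `q`, so
    -- its cost is taken at the bound `X + q`; the test, the two sequencings, the constant and the
    -- decrement add five steps per round.
    refine ⟨p + (q * (r.comp (.X + q) + 5) + 2), fun ρ X s h1 hs hX => ?_⟩
    obtain ⟨s₁, t₁, ht₁, hr₁, hlt₁, hm₁, he₁⟩ := hp ρ X _ s le_rfl hs hX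
    have key : ∀ (N : ℕ) (s : State), N ≤ q.eval X → Holds s ρ → s.reg ρ.length = N →
        (∀ a, s.mem a ≤ X) → ∃ s' t, t ≤ N * ((r.comp (.X + q)).eval X + 5) + 1 ∧
          Runs (.loop ρ.length (.seq (.const (ρ.length + 1) 1)
            (.seq (.sub ρ.length ρ.length (ρ.length + 1)) (S.compile (ρ.length + 1))))) s s' t ∧
          (∀ i < ρ.length, s'.reg i = s.reg i) ∧
          s'.mem = iterateDown (fun i => S.run (ρ ++ [i])) N s.mem := by
      intro N
      induction N with
      | zero => exact fun s _ _ h _ => ⟨s, 1, by simp, Runs.loop_zero h, fun _ _ => rfl, rfl⟩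
      | succ N ih =>
        intro s hN hs hd hX'
        -- The decremented counter register serves as the loop variable, which is why loops run
        -- downwards.
        set s₀ := (s.setReg (ρ.length + 1) 1).setReg ρ.length N with hs₀
        have hlt₀ : ∀ i < ρ.length, s₀.reg i = s.reg i := fun i hi => by
          rw [hs₀, State.setReg_reg_of_ne _ _ (by lia), State.setReg_reg_of_ne _ _ (by lia)]
        have hsub := runs_sub (s.setReg (ρ.length + 1) 1) ρ.length ρ.length (ρ.length + 1)
        rw [State.setReg_reg_self, State.setReg_reg_of_ne _ _ (by lia), hd, Nat.add_sub_cancel,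
          ← hs₀] at hsub
        obtain ⟨s₁, t₁, ht₁, hr₁, hlt₁, hm₁⟩ := hr (ρ ++ [N]) (X + q.eval X) s₀ (by lia)
          (fun i hi => by
            rcases Nat.lt_or_ge i ρ.length with h | h
            · rw [hlt₀ i h, hs i h, List.getElem_append_left h]
            · have : i = ρ.length := by simp at hi; lia
              subst this
              simp [hs₀])
          ⟨fun x hx => by
            rcases List.mem_append.1 hx with h | h
            · exact (hX.1 x h).trans (by lia)
            · simp at h; lia, fun a => (hX' a).trans (by lia)⟩
        rw [List.length_append, List.length_singleton] at hr₁ hlt₁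
        have hlt₁' : ∀ i < ρ.length, s₁.reg i = s.reg i := fun i hi => by
          rw [hlt₁ i (by lia), hlt₀ i hi]
        have hmem : s₁.mem = S.run (ρ ++ [N]) s.mem := hm₁
        obtain ⟨s₂, t₂, ht₂, hr₂, hlt₂, hm₂⟩ := ih s₁ (by lia) (hs.congr hlt₁')
          (by rw [hlt₁ _ (by lia)]; simp [hs₀])
          (by rw [hmem]; exact S.run_le X h1 _ _ hX')
        refine ⟨s₂, _, ?_, Runs.loop_succ (by rw [hd]; lia)
          ((runs_const _ _ _).seq (hsub.seq hr₁)) hr₂, fun i hi => ?_, ?_⟩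
        · simp only [Polynomial.eval_comp, Polynomial.eval_add, Polynomial.eval_X] at ht₂ ⊢
          rw [Nat.succ_mul]
          lia
        · rw [hlt₂ i hi, hlt₁' i hi]
        · rw [hm₂, hmem]; rfl
    have hN := hq _ _ _ hX
    obtain ⟨s₂, t₂, ht₂, hr₂, hlt₂, hm₂⟩ := key _ s₁ hN (hs.congr hlt₁) he₁ (hm₁ ▸ hX.2)
    refine ⟨s₂, _, ?_, hr₁.seq hr₂, fun i hi => (hlt₂ i hi).trans (hlt₁ i hi), ?_⟩
    · have := Nat.mul_le_mul_right ((r.comp (.X + q)).eval X + 5) hN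
      simp only [Polynomial.eval_add, Polynomial.eval_mul, Polynomial.eval_ofNat] at this ⊢
      lia
    · rw [hm₂, hm₁, Stmt.run]

/-- A statement followed by the evaluation of an expression is a polynomial-time program, for all
inputs with entries polynomially bounded in `n`. -/
theorem exists_outputsWithin (S : Stmt) (e : Expr) : ∃ (P : Program) (p : Polynomial ℕ),
    ∀ (n : ℕ) (input : List ℕ), (∀ x ∈ input, x ≤ n + 1) →
      OutputsWithin P input (p.eval n)
        (e.eval [] (S.run [] fun i => input.getD i 0)) := by
  obtain ⟨p, hp⟩ := S.exists_runs_compile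
  obtain ⟨q, hq⟩ := e.exists_runs_compile
  refine ⟨.seq (S.compile 0) (e.compile 0 0), (p + q + 1).comp (.X + 1), fun n input hin => ?_⟩
  have hmem : ∀ a, (initState input).mem a ≤ n + 1 := fun a => by
    simp only [initState, List.getD_eq_getElem?_getD]
    by_cases h : a < input.length
    · simpa [h] using hin _ (List.getElem_mem h)
    · simp [not_lt.1 h]
  have h0 (s : State) : Holds s [] := fun i hi => by simp at hi
  obtain ⟨s₁, t₁, ht₁, hr₁, -, hm₁⟩ := hp [] (n + 1) (initState input) (by lia) (h0 _)
    ⟨by simp, hmem⟩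
  obtain ⟨s₂, t₂, ht₂, hr₂, -, -, he₂⟩ := hq [] (n + 1) 0 s₁ (by simp) (h0 _)
    ⟨by simp, hm₁ ▸ S.run_le _ (by lia) _ _ hmem⟩
  refine ⟨_, ?_, s₂, hr₁.seq hr₂ [], ?_⟩
  · simp only [Polynomial.eval_comp, Polynomial.eval_add, Polynomial.eval_X, Polynomial.eval_one]
    lia
  · rw [he₂, hm₁]; rfl

/-! ### Reasoning about the set of cells that a statement makes nonzero. -/

/-- `S` preserves the invariant `Inv`, and the cells that it makes nonzero are those in `W`. -/
def Computes (S : Stmt) (ρ : List ℕ) (Inv : (ℕ → ℕ) → Prop) (W : ℕ → Prop) : Prop :=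
  ∀ m, Inv m → Inv (S.run ρ m) ∧ ∀ x, S.run ρ m x ≠ 0 ↔ m x ≠ 0 ∨ W x

section Computes

variable {S T : Stmt} {ρ : List ℕ} {Inv : (ℕ → ℕ) → Prop} {W W' : ℕ → Prop}

theorem Computes.congr (h : Computes S ρ Inv W) (hW : ∀ x, W x ↔ W' x) : Computes S ρ Inv W' :=
  funext (fun x => propext (hW x)) ▸ h

theorem computes_put {c e : Expr} {p : Prop} {a : ℕ} (hc : ∀ m, Inv m → (c.eval ρ m ≠ 0 ↔ p))
    (he : ∀ m, Inv m → p → e.eval ρ m = a)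
    (hInv : p → ∀ m, Inv m → Inv (Function.update m a 1)) :
    Computes (.put c e) ρ Inv fun x => p ∧ x = a := by
  intro m hm
  rw [Stmt.run]
  by_cases hp : p
  · rw [if_pos ((hc m hm).2 hp), he m hm hp]
    refine ⟨hInv hp m hm, fun x => ?_⟩
    by_cases hx : x = a <;> simp [hx, hp]
  · rw [if_neg (fun h => hp ((hc m hm).1 h))]
    simp [hp, hm]

theorem Computes.seq (hS : Computes S ρ Inv W) (hT : Computes T ρ Inv W') :
    Computes (.seq S T) ρ Inv fun x => W x ∨ W' x := by
  intro m hm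
  obtain ⟨h1, h2⟩ := hS m hm
  obtain ⟨h3, h4⟩ := hT _ h1
  exact ⟨h3, fun x => by rw [Stmt.run, h4, h2, or_assoc]⟩

/-- Since `W i` does not depend on the memory, the order of the rounds is irrelevant and their
effects simply unite. -/
theorem computes_forBelow {e : Expr} {N : ℕ} {W : ℕ → ℕ → Prop}
    (he : ∀ m, Inv m → e.eval ρ m = N) (hS : ∀ i < N, Computes S (ρ ++ [i]) Inv (W i)) :
    Computes (.forBelow e S) ρ Inv fun x => ∃ i < N, W i x := by
  intro m hm
  rw [Stmt.run, he m hm]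
  clear he
  induction N generalizing m with
  | zero => simp [iterateDown, hm]
  | succ N ih =>
    obtain ⟨h1, h2⟩ := hS N (by lia) m hm
    obtain ⟨h3, h4⟩ := ih (fun i hi => hS i (by lia)) _ h1
    refine ⟨h3, fun x => ?_⟩
    change _ ↔ _ ∨ ∃ i < N + 1, W i x
    rw [iterateDown, h4, h2, Nat.exists_lt_succ_right, or_assoc, or_comm (a := W N x)]

end Computes

end RAM

/-! ### Half-spaces of the monophonic convexity -/

namespace SimpleGraph.Walk

variable {V : Type*} {G : SimpleGraph V}

/-- Replace the segment from `x` to `y` by the chord. The segment has length at least two: it is not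
empty as `x ≠ y`, and a single edge would be the chord itself. -/
theorem exists_shorter_of_adj [DecidableEq V] {u v x y : V} (p : G.Walk u v) (hx : x ∈ p.support)
    (hy : y ∈ (p.dropUntil x hx).support) (hadj : G.Adj x y) (he : s(x, y) ∉ p.edges) :
    ∃ q : G.Walk u v, q.length < p.length ∧ q.support ⊆ p.support := by
  refine ⟨(p.takeUntil x hx).append (.cons hadj ((p.dropUntil x hx).dropUntil y hy)), ?_, ?_⟩
  · have h1 := congrArg length (p.take_spec hx)
    have h2 := congrArg length ((p.dropUntil x hx).take_spec hy)
    rw [length_append] at h1 h2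
    rw [length_append, length_cons]
    have h0 : ((p.dropUntil x hx).takeUntil y hy).length ≠ 0 := fun h =>
      hadj.ne (eq_of_length_eq_zero h)
    have h1' : ((p.dropUntil x hx).takeUntil y hy).length ≠ 1 := fun h => by
      refine he (p.edges_dropUntil_subset_edges hx
        ((p.dropUntil x hx).edges_takeUntil_subset_edges hy ?_))
      generalize (p.dropUntil x hx).takeUntil y hy = q at h
      cases q with
      | nil => simp at h
      | cons h' q =>
        cases q with
        | nil => simp
        | cons _ _ => simp at h
    lia
  · intro z hz
    rw [mem_support_append_iff, support_cons, List.mem_cons] at hz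
    rcases hz with hz | rfl | hz
    · exact p.support_takeUntil_subset_support hx hz
    · exact hx
    · exact p.support_dropUntil_subset_support hx
        ((p.dropUntil x hx).support_dropUntil_subset_support hy hz)

/-- Every walk can be shortened to a chordless path. -/
theorem exists_isPath_isChordless {u v : V} (p : G.Walk u v) :
    ∃ q : G.Walk u v, q.IsPath ∧ q.IsChordless ∧ q.support ⊆ p.support := by
  classical
  induction hn : p.length using Nat.strong_induction_on generalizing p with
  | _ n ih =>
    by_cases hs : ∃ q : G.Walk u v, q.length < p.length ∧ q.support ⊆ p.support
    · obtain ⟨q, hq, hsub⟩ := hs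
      obtain ⟨r, h1, h2, h3⟩ := ih _ (hn ▸ hq) q rfl
      exact ⟨r, h1, h2, fun z hz => hsub (h3 hz)⟩
    -- No walk inside the support is shorter, so removing cycles costs no length, and the resulting
    -- path is again shortest within its support. A chord would contradict this.
    · have hb : p.bypass.length = p.length :=
        le_antisymm p.length_bypass_le_length (not_lt.1 fun h =>
          hs ⟨_, h, p.support_bypass_subset_support⟩)
      have hs' : ¬ ∃ q : G.Walk u v, q.length < p.bypass.length ∧
          q.support ⊆ p.bypass.support := fun ⟨q, h1, h2⟩ =>
        hs ⟨q, hb ▸ h1, fun z hz => p.support_bypass_subset_support (h2 hz)⟩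
      refine ⟨p.bypass, p.bypass_isPath, isChordless_iff_forall_mem_edges.2 ?_,
        p.support_bypass_subset_support⟩
      generalize p.bypass = p at hs'
      intro x y hx hy hadj
      by_contra he
      have hy' := hy
      rw [← p.take_spec hx, mem_support_append_iff] at hy'
      rcases hy' with h | h
      · refine hs' (exists_shorter_of_adj p hy (y := x) ?_ hadj.symm (by rwa [Sym2.eq_swap]))
        have h2 := hx
        rw [← p.take_spec hy, mem_support_append_iff] at h2
        refine h2.resolve_left fun h2 => ?_
        exact notMem_support_takeUntil_support_takeUntil_subset hadj.ne.symm hx h h2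
      · exact hs' (exists_shorter_of_adj p hx h hadj he)

theorem IsPath.eq_of_mem_takeUntil_of_mem_dropUntil [DecidableEq V] {u v w x : V} {p : G.Walk u v}
    (hp : p.IsPath) (hw : w ∈ p.support) (h1 : x ∈ (p.takeUntil w hw).support)
    (h2 : x ∈ (p.dropUntil w hw).support) : x = w := by
  by_contra hne
  have hnd := hp.support_nodup
  rw [← p.take_spec hw, support_append, List.nodup_append] at hnd
  rw [mem_support_iff] at h2
  exact hnd.2.2 x h1 x (h2.resolve_left hne) rfl

end SimpleGraph.Walk

namespace Monophonic

variable {V : Type*} {G : SimpleGraph V} {C H : Set V}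

/-- The inner boundary of a vertex set. -/
def boundary (G : SimpleGraph V) (C : Set V) : Set V :=
  {x | x ∈ C ∧ ∃ y ∉ C, G.Adj x y}

theorem isConvex_iff : IsConvex G C ↔ ∀ u ∈ C, ∀ v ∈ C, interval G u v ⊆ C := by
  constructor
  · intro h u hu v hv w hw
    rw [← h]
    exact Set.mem_biUnion hu (Set.mem_biUnion hv hw)
  · intro h
    refine Set.Subset.antisymm (Set.iUnion₂_subset fun u hu => Set.iUnion₂_subset (h u hu)) ?_
    intro u hu
    refine Set.mem_biUnion hu (Set.mem_biUnion hu ⟨.nil, by simp, ?_, by simp⟩)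
    rw [SimpleGraph.Walk.isChordless_iff_forall_mem_edges]
    simp

/-- Any walk shortens to a chordless path, and convexity keeps that path inside: convex sets induce
connected subgraphs. -/
theorem IsConvex.exists_walk (hC : IsConvex G C) (hG : G.Connected) {u v : V} (hu : u ∈ C)
    (hv : v ∈ C) : ∃ p : G.Walk u v, ∀ w ∈ p.support, w ∈ C := by
  obtain ⟨p⟩ := hG u v
  obtain ⟨q, h1, h2, -⟩ := p.exists_isPath_isChordless
  exact ⟨q, fun w hw => isConvex_iff.1 hC u hu v hv ⟨q, h1, h2, hw⟩⟩

/-- Join the outer neighbours of `x` and `y` by a walk in the complement and shorten the resulting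
walk from `x` to `y` to a chordless path. By convexity this path stays in `C`, so only `x` and `y`
are left on it, and they are adjacent. -/
theorem IsConvex.isClique_boundary (hC : IsConvex G C) (hC' : IsConvex G Cᶜ)
    (hG : G.Connected) : G.IsClique (boundary G C) := by
  rintro x ⟨hx, x', hx', hxx'⟩ y ⟨hy, y', hy', hyy'⟩ hne
  obtain ⟨p, hp⟩ := hC'.exists_walk hG hx' hy'
  obtain ⟨q, h1, h2, h3⟩ :=
    (SimpleGraph.Walk.cons hxx' (p.concat hyy'.symm)).exists_isPath_isChordless
  have hq : ∀ w ∈ q.support, w = x ∨ w = y := fun w hw => by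
    have hwC : w ∈ C := isConvex_iff.1 hC x hx y hy ⟨q, h1, h2, hw⟩
    have := h3 hw
    simp only [SimpleGraph.Walk.support_cons, SimpleGraph.Walk.support_concat, List.mem_cons,
      List.mem_append] at this
    rcases this with h | h | h
    · exact .inl h
    · exact absurd hwC (hp w h)
    · simp at h; exact .inr h
  cases q with
  | nil => exact absurd rfl hne
  | @cons _ z _ h r =>
    rcases hq z (by simp) with rfl | rfl
    · exact absurd rfl h.ne
    · exact h

/-- A chordless path that visits `w ∉ C` leaves `C` before `w` and re-enters it after `w`, at two
boundary vertices. These are adjacent, and the edge between them is a chord. -/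
theorem isConvex_of_isClique_boundary (h : G.IsClique (boundary G C)) : IsConvex G C := by
  classical
  rw [isConvex_iff]
  rintro u hu v hv w ⟨p, hp, hch, hw⟩
  by_contra hwC
  obtain ⟨d, hd, hdC, hdC'⟩ := (p.takeUntil w hw).exists_boundary_dart C hu hwC
  obtain ⟨e, he, heC, heC'⟩ := (p.dropUntil w hw).exists_boundary_dart Cᶜ hwC (not_not.2 hv)
  have heC' := not_not.1 heC'
  have hx := (p.takeUntil w hw).dart_fst_mem_support_of_mem_darts hd
  have hy := (p.dropUntil w hw).dart_snd_mem_support_of_mem_darts he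
  have hx' : d.fst ∉ (p.dropUntil w hw).support := fun h =>
    hwC (hp.eq_of_mem_takeUntil_of_mem_dropUntil hw hx h ▸ hdC)
  have hy' : e.snd ∉ (p.takeUntil w hw).support := fun h =>
    hwC (hp.eq_of_mem_takeUntil_of_mem_dropUntil hw h hy ▸ heC')
  have hadj : G.Adj d.fst e.snd := h ⟨hdC, _, hdC', d.adj⟩ ⟨heC', _, heC, e.adj.symm⟩
    fun heq => hx' (heq ▸ hy)
  have hedge := hch.mem_edges (p.support_takeUntil_subset_support hw hx)
    (p.support_dropUntil_subset_support hw hy) hadj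
  rw [← p.take_spec hw, SimpleGraph.Walk.edges_append, List.mem_append] at hedge
  rcases hedge with h | h
  · exact hy' (SimpleGraph.Walk.snd_mem_support_of_mem_edges _ h)
  · exact hx' (SimpleGraph.Walk.fst_mem_support_of_mem_edges _ h)

/-- In a connected graph, half-spaces are the sets such that the two boundaries are cliques. -/
theorem isHalfSpace_iff (hG : G.Connected) :
    IsHalfSpace G H ↔ G.IsClique (boundary G H) ∧ G.IsClique (boundary G Hᶜ) :=
  ⟨fun h => ⟨h.1.isClique_boundary h.2 hG,
      h.2.isClique_boundary (by rw [compl_compl]; exact h.1) hG⟩,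
    fun h => ⟨isConvex_of_isClique_boundary h.1, isConvex_of_isClique_boundary h.2⟩⟩

end Monophonic

/-! ### Satisfiability of implications between literals -/

namespace TwoSat

open Relation

variable {V : Type*}

/-- The negation of a literal. -/
def neg (p : Bool × V) : Bool × V := (!p.1, p.2)

@[simp] theorem neg_neg (p : Bool × V) : neg (neg p) = p := by simp [neg]

/-- A literal `(s, v)` is true for `H` if `v ∈ H` is equivalent to `s`. -/
def IsTrue (H : Set V) (p : Bool × V) : Prop := p.2 ∈ H ↔ p.1 = true

theorem isTrue_neg {H : Set V} {p : Bool × V} : IsTrue H (neg p) ↔ ¬ IsTrue H p := by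
  obtain ⟨_ | _, v⟩ := p <;> simp [IsTrue, neg]

theorem TransGen.neg_neg {R : Bool × V → Bool × V → Prop} (hR : ∀ p q, R p q → R (neg q) (neg p))
    {p q : Bool × V} (h : TransGen R p q) : TransGen R (neg q) (neg p) := by
  induction h with
  | single h => exact .single (hR _ _ h)
  | tail _ h ih => exact .head (hR _ _ h) ih

/-- A set of implications between literals that is closed under contraposition is satisfiable if
and only if no literal is equivalent to its negation. -/
theorem exists_forall_isTrue_iff [Finite V] {R : Bool × V → Bool × V → Prop}
    (hR : ∀ p q, R p q → R (neg q) (neg p)) :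
    (∃ H : Set V, ∀ p q, R p q → IsTrue H p → IsTrue H q) ↔
      ¬ ∃ p, TransGen R p (neg p) ∧ TransGen R (neg p) p := by
  constructor
  · rintro ⟨H, hH⟩ ⟨p, h1, h2⟩
    have key : ∀ p q, TransGen R p q → IsTrue H p → IsTrue H q := fun p q h hp => by
      induction h with
      | single h => exact hH _ _ h hp
      | tail _ h ih => exact hH _ _ h ih
    have h1 := key _ _ h1
    have h2 := key _ _ h2
    rw [isTrue_neg] at h1 h2
    tauto
  · intro h
    -- A maximal consistent set of literals closed under implication turns out to decide every
    -- literal, and so is an assignment.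
    let Good (S : Set (Bool × V)) : Prop := (∀ p ∈ S, neg p ∉ S) ∧ ∀ p ∈ S, ∀ q, R p q → q ∈ S
    obtain ⟨S, hS⟩ := (Set.toFinite {S | Good S}).exists_maximal ⟨∅, by simp [Good]⟩
    have closed : ∀ p ∈ S, ∀ q, TransGen R p q → q ∈ S := fun p hp q hpq => by
      induction hpq with
      | single h => exact hS.1.2 _ hp _ h
      | tail _ h ih => exact hS.1.2 _ ih _ h
    -- Otherwise `p` and all its consequences could be added. If `p` implies both `q` and `neg q`,
    -- contraposition of the latter shows that `p` implies `neg p`.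
    have key : ∀ p, p ∉ S → neg p ∉ S → ¬ TransGen R p (neg p) → False := fun p hp hnp hne => by
      refine hp (hS.2 (y := S ∪ {q | q = p ∨ TransGen R p q}) ⟨?_, ?_⟩ Set.subset_union_left
        (Or.inr (Or.inl rfl)))
      · have aux : ∀ q, TransGen R p q → neg q ∉ S := fun q hq hqS =>
          hnp (closed _ hqS _ (TransGen.neg_neg hR hq))
        rintro q (hq | rfl | hq) (hq' | hq' | hq')
        · exact hS.1.1 q hq hq'
        · exact hnp (by rw [← hq', neg_neg]; exact hq)
        · exact aux _ hq' (by rwa [neg_neg])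
        · exact hnp hq'
        · simp [neg, Prod.ext_iff] at hq'
        · exact hne hq'
        · exact aux _ hq hq'
        · subst hq'
          exact hne (by rwa [neg_neg])
        · have := TransGen.neg_neg hR hq'
          rw [neg_neg] at this
          exact hne (hq.trans this)
      · rintro q (hq | rfl | hq) r hqr
        · exact .inl (hS.1.2 q hq r hqr)
        · exact .inr (.inr (.single hqr))
        · exact .inr (.inr (hq.tail hqr))
    -- If `p` implies its negation, then `neg p` does not imply `p`, and `key` applies to `neg p`
    -- instead.
    have total : ∀ p, p ∈ S ∨ neg p ∈ S := fun p => by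
      by_contra hcon
      push Not at hcon
      by_cases hp : TransGen R p (neg p)
      · exact key (neg p) hcon.2 (by rw [neg_neg]; exact hcon.1) (by
          rw [neg_neg]; exact fun hp' => h ⟨p, hp, hp'⟩)
      · exact key p hcon.1 hcon.2 hp
    have hH : ∀ p, IsTrue {v | (true, v) ∈ S} p ↔ p ∈ S := by
      rintro ⟨_ | _, v⟩
      · have h1 := hS.1.1 (true, v)
        have h2 := total (true, v)
        simp only [neg, Bool.not_true] at h1 h2
        simp only [IsTrue, Set.mem_ofPred_eq]
        tauto
      · simp [IsTrue]
    exact ⟨{v | (true, v) ∈ S}, fun p q hpq => by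
      rw [hH, hH]; exact fun hp => hS.1.2 p hp q hpq⟩

end TwoSat

/-! ### Separation of linked sets as implications between literals. -/

namespace Monophonic

open TwoSat

variable {V : Type*} (G : SimpleGraph V)

open Classical in
/-- For an edge `ab` with `a` on side `s` and `b` on the other side, this literal is false only if
the vertex `u`, a neighbour of `a` and of `v`, is in the boundary of side `s`. -/
noncomputable def interiorLiteral (s : Bool) (b u v : V) : Bool × V :=
  if G.Adj u b then (!s, u) else (s, v)

/-- Implications between literals which hold for every half-space that separates the edge `ab`,
with `a` on side `s`. -/
inductive EdgeImplies (s : Bool) (a b : V) : Bool × V → Bool × V → Prop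
  | cut (u v : V) : G.Adj u v → ¬ ((u = a ∨ G.Adj a u) ∧ (v = b ∨ G.Adj b v)) →
      EdgeImplies s a b (s, u) (s, v)
  | clique (u v u' v' : V) : G.Adj a u → G.Adj a u' → u ≠ b → u' ≠ b → u ≠ u' → ¬ G.Adj u u' →
      G.Adj u v → G.Adj u' v' →
      EdgeImplies s a b (neg (interiorLiteral G s b u v)) (interiorLiteral G s b u' v')

/-- Of two sets, the one for side `s`. -/
def side (A B : Set V) (s : Bool) : Set V := if s then A else B

/-- The implications between literals that express the separation of `A` and `B`. -/
inductive Implies (A B : Set V) : Bool × V → Bool × V → Prop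
  | unit (s : Bool) (a : V) : a ∈ side A B s → Implies A B (!s, a) (s, a)
  | edge (s : Bool) (a b : V) (p q : Bool × V) : a ∈ side A B s → b ∈ side A B (!s) → G.Adj a b →
      EdgeImplies G s a b p q → Implies A B p q

variable {G} {A B H : Set V}

/-- The contrapositive of a `cut` implication is the one for the reversed edge `ba` on the other
side; that of a `clique` implication exchanges the two pairs. -/
theorem Implies.contraposition {p q : Bool × V} (h : Implies G A B p q) :
    Implies G A B (neg q) (neg p) := by
  cases h with
  | unit s a h => simpa [neg] using Implies.unit s a h
  | edge s a b _ _ ha hb hab h =>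
    cases h with
    | cut u v huv h =>
      refine .edge (!s) b a _ _ hb (by simpa) hab.symm (.cut v u huv.symm ?_)
      tauto
    | clique u v u' v' h1 h2 h3 h4 h5 h6 h7 h8 =>
      refine .edge s a b _ _ ha hb hab ?_
      rw [neg_neg]
      exact .clique u' v' u v h2 h1 h4 h3 h5.symm (fun h => h6 h.symm) h8 h7

theorem mem_side_compl {s : Bool} {v : V} : v ∈ side H Hᶜ s ↔ IsTrue H (s, v) := by
  cases s <;> simp [side, IsTrue]

theorem side_not : side H Hᶜ (!s) = (side H Hᶜ s)ᶜ := by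
  cases s <;> simp [side]

/-- The implications hold for a half-space. -/
theorem EdgeImplies.isTrue {s : Bool} {a b : V} {p q : Bool × V} (h : EdgeImplies G s a b p q)
    (hH : ∀ s, G.IsClique (boundary G (side H Hᶜ s))) (hab : G.Adj a b)
    (ha : a ∈ side H Hᶜ s) (hb : b ∉ side H Hᶜ s) (hp : IsTrue H p) : IsTrue H q := by
  have hc := hH s
  have hc' := hH (!s)
  rw [side_not] at hc'
  have hT : ∀ v, IsTrue H (s, v) ↔ v ∈ side H Hᶜ s := fun v => mem_side_compl.symm
  have hF : ∀ v, IsTrue H (!s, v) ↔ v ∉ side H Hᶜ s := fun v => by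
    rw [← mem_side_compl, side_not]; rfl
  generalize side H Hᶜ s = K at *
  have ha' : a ∈ boundary G K := ⟨ha, b, hb, hab⟩
  have hb' : b ∈ boundary G Kᶜ := ⟨hb, a, not_not.2 ha, hab.symm⟩
  cases h with
  | cut u v huv h =>
    rw [hT] at hp ⊢
    by_contra hv
    refine h ⟨or_iff_not_imp_left.2 fun hne => ?_, or_iff_not_imp_left.2 fun hne => ?_⟩
    · exact hc ha' ⟨hp, v, hv, huv⟩ (Ne.symm hne)
    · exact hc' hb' ⟨hv, u, not_not.2 hp, huv.symm⟩ (Ne.symm hne)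
  | clique u v u' v' h1 h2 h3 h4 h5 h6 h7 h8 =>
    -- If `u` is adjacent to `b`, then `b` is its outer neighbour. If not, `u ∉ K` would make `u`
    -- and `b` distinct members of the boundary clique of the complement, hence adjacent; so `u ∈
    -- K`, with outer neighbour `v`.
    have key : ∀ u v, G.Adj a u → u ≠ b → G.Adj u v → ¬ IsTrue H (interiorLiteral G s b u v) →
        u ∈ boundary G K := fun u v hau hub huv h => by
      rw [interiorLiteral] at h
      split_ifs at h with hadj
      · rw [hF, not_not] at h
        exact ⟨h, b, hb, hadj⟩
      · rw [hT] at h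
        refine ⟨?_, v, h, huv⟩
        by_contra hu
        exact hadj (hc' ⟨hu, a, not_not.2 ha, hau.symm⟩ hb' hub)
    by_contra hq
    exact h6 (hc (key u v h1 h3 h7 (isTrue_neg.1 hp)) (key u' v' h2 h4 h8 hq) h5)

/-- A set that satisfies the implications of an edge has clique boundaries. -/
theorem isClique_boundary_of_edgeImplies {s : Bool} {a b : V}
    (h : ∀ p q, EdgeImplies G s a b p q → IsTrue H p → IsTrue H q)
    (hb : b ∉ side H Hᶜ s) :
    G.IsClique (boundary G (side H Hᶜ s)) := by
  have hT : ∀ v, IsTrue H (s, v) ↔ v ∈ side H Hᶜ s := fun v => mem_side_compl.symm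
  have hF : ∀ v, IsTrue H (!s, v) ↔ v ∉ side H Hᶜ s := fun v => by
    rw [← mem_side_compl, side_not]; rfl
  generalize side H Hᶜ s = K at *
  rintro u ⟨hu, v, hv, huv⟩ u' ⟨hu', v', hv', huv'⟩ hne
  by_contra hadj
  have near : ∀ u v, u ∈ K → v ∉ K → G.Adj u v → u = a ∨ G.Adj a u := fun u v hu hv huv => by
    by_contra hcon
    exact hv ((hT v).1 (h _ _ (.cut u v huv (fun hc => hcon hc.1)) ((hT u).2 hu)))
  have key : ∀ u v, u ∈ K → v ∉ K → ¬ IsTrue H (interiorLiteral G s b u v) := fun u v hu hv => by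
    rw [interiorLiteral]
    split_ifs
    · rwa [hF, not_not]
    · rwa [hT]
  have hau := near u v hu hv huv
  have hau' := near u' v' hu' hv' huv'
  -- If `u = a`, then `u'`, which is `a` or a neighbour of `a`, would equal `u` or be adjacent to
  -- it.
  have hau : G.Adj a u := hau.resolve_left fun h => by
    subst h
    exact hau'.elim (fun h => hne h.symm) hadj
  have hau' : G.Adj a u' := hau'.resolve_left fun h => hadj (h ▸ hau.symm)
  exact key u' v' hu' hv' (h _ _ (.clique u v u' v' hau hau' (fun h => hb (h ▸ hu))
    (fun h => hb (h ▸ hu')) hne hadj huv huv') (isTrue_neg.2 (key u v hu hv)))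

/-- Linked sets in a connected graph are separable if and only if the implications are
satisfiable. -/
theorem separable_iff (hG : G.Connected) (hAB : Linked G A B) :
    Separable G A B ↔ ∃ H : Set V, ∀ p q, Implies G A B p q → IsTrue H p → IsTrue H q := by
  have hhalf : ∀ H : Set V, IsHalfSpace G H ↔ ∀ s, G.IsClique (boundary G (side H Hᶜ s)) :=
    fun H => by rw [isHalfSpace_iff hG]; simp [side, Bool.forall_bool, and_comm]
  have hnot : ∀ (H : Set V) s v, v ∈ side H Hᶜ (!s) → v ∉ side H Hᶜ s := fun H s v h => by
    rwa [side_not] at h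
  constructor
  · rintro ⟨H, hH, hA, hB⟩
    have hside : ∀ s, side A B s ⊆ side H Hᶜ s := by
      rintro (_ | _) <;> simpa [side]
    refine ⟨H, fun p q h hp => ?_⟩
    cases h with
    | unit s a h => exact mem_side_compl.1 (hside s h)
    | edge s a b _ _ ha hb hab h =>
      exact h.isTrue ((hhalf H).1 hH) hab (hside s ha) (hnot H s b (hside _ hb)) hp
  · rintro ⟨H, hH⟩
    have hside : ∀ s, side A B s ⊆ side H Hᶜ s := fun s a ha => by
      by_contra h
      rw [mem_side_compl] at h
      exact h (hH _ _ (.unit s a ha) (isTrue_neg.2 h))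
    -- A single linking edge suffices: read from `a` it controls one boundary, read from `b` the
    -- other.
    obtain ⟨a, ha, b, hb, hab⟩ := hAB
    refine ⟨H, (hhalf H).2 ?_, hside true, hside false⟩
    rintro (_ | _)
    · exact isClique_boundary_of_edgeImplies (a := b) (b := a)
        (fun p q h => hH p q (.edge false b a p q hb ha hab.symm h))
        (hnot H false a (hside true ha))
    · exact isClique_boundary_of_edgeImplies (a := a) (b := b)
        (fun p q h => hH p q (.edge true a b p q ha hb hab h)) (hnot H true b (hside false hb))

end Monophonic

/-! ### The separation algorithm -/

namespace Monophonic

open RAM TwoSat Relation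

/-! ### Numbering of literals and layout of the memory. -/

section Layout

variable {n : ℕ} {G : SimpleGraph (Fin n)} {A B : Set (Fin n)}

/-- The number of a literal. -/
def literalIndex (p : Bool × Fin n) : ℕ := (if p.1 then 0 else n) + p.2

theorem literalIndex_lt (p : Bool × Fin n) : literalIndex p < n + n := by
  rw [literalIndex]
  split_ifs <;> lia

theorem literalIndex_injective : Function.Injective (literalIndex (n := n)) := by
  rintro ⟨_ | _, v⟩ ⟨_ | _, w⟩ h <;> simp [literalIndex, Fin.ext_iff] at h ⊢ <;> lia

theorem exists_literalIndex_eq {i : ℕ} (hi : i < n + n) : ∃ p : Bool × Fin n,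
    literalIndex p = i := by
  rcases Nat.lt_or_ge i n with h | h
  · exact ⟨(true, ⟨i, h⟩), by simp [literalIndex]⟩
  · exact ⟨(false, ⟨i - n, by lia⟩), by simp [literalIndex]; lia⟩

variable (n) in
/-- The number of entries of the input, which is the address of a flag. -/
def flagCell : ℕ := 1 + n * n + n + n

/-- The address of the truth value of an implication between two literals. -/
def implicationCell (p q : Bool × Fin n) : ℕ :=
  flagCell n + (1 + (literalIndex p * (n + n) + literalIndex q))

theorem flagCell_lt_implicationCell (p q : Bool × Fin n) : flagCell n < implicationCell p q := by
  rw [implicationCell]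
  lia

theorem implicationCell_inj {p q p' q' : Bool × Fin n} :
    implicationCell p q = implicationCell p' q' ↔ p = p' ∧ q = q' := by
  refine ⟨fun h => ?_, fun ⟨h, h'⟩ => h ▸ h' ▸ rfl⟩
  have h : literalIndex q + literalIndex p * (n + n) =
      literalIndex q' + literalIndex p' * (n + n) := by
    simp only [implicationCell] at h
    lia
  have hq := literalIndex_lt q
  have hq' := literalIndex_lt q'
  have h1 := congrArg (· / (n + n)) h
  have h2 := congrArg (· % (n + n)) h
  simp only [Nat.add_mul_div_right _ _ (Nat.zero_lt_of_lt hq), Nat.div_eq_of_lt hq,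
    Nat.div_eq_of_lt hq', Nat.add_mul_mod_self_right, Nat.mod_eq_of_lt hq, Nat.mod_eq_of_lt hq',
    zero_add] at h1 h2
  exact ⟨literalIndex_injective h1, literalIndex_injective h2⟩

variable (G A B) in
/-- The memory holds the input. -/
structure HoldsInput (m : ℕ → ℕ) : Prop where
  size : m 0 = n
  adj (u v : Fin n) : m (1 + (u * n + v)) = bit (G.Adj u v)
  -- The indicator vectors of `A` and `B` are adjacent in the input, so that literal numbers serve
  -- as offsets into both.
  side (s : Bool) (u : Fin n) : m (1 + n * n + literalIndex (s, u)) = bit (u ∈ side A B s)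

theorem HoldsInput.update {m : ℕ → ℕ} (h : HoldsInput G A B m) {x : ℕ} (hx : flagCell n ≤ x)
    (c : ℕ) : HoldsInput G A B (Function.update m x c) := by
  rw [flagCell] at hx
  refine ⟨?_, fun u v => ?_, fun s u => ?_⟩
  · rw [Function.update_of_ne (by lia), h.size]
  · have : (u : ℕ) * n + v < n * n := by nlinarith [u.2, v.2]
    rw [Function.update_of_ne (by lia), h.adj]
  · have := literalIndex_lt (s, u)
    rw [Function.update_of_ne (by lia), h.side]

theorem length_encode : (encode G A B).length = flagCell n := by
  simp [encode, flagCell]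
  lia

theorem holdsInput_encode : HoldsInput G A B fun i => (encode G A B).getD i 0 := by
  refine ⟨by simp [encode], fun u v => ?_, fun s u => ?_⟩
  · have h : (u : ℕ) * n + v < n * n := by nlinarith [u.2, v.2]
    have h1 : (⟨u * n + v, h⟩ : Fin (n * n)).divNat = u := by
      ext
      simp [Fin.divNat, mul_comm (u : ℕ), Nat.mul_add_div u.pos]
    have h2 : (⟨u * n + v, h⟩ : Fin (n * n)).modNat = v := by
      ext
      simp [Fin.modNat, mul_comm (u : ℕ), Nat.mod_eq_of_lt v.2]
    simp only [encode]
    rw [List.append_assoc, List.append_assoc, List.getD_append_right _ _ _ _ (by simp),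
      List.getD_append _ _ _ _ (by simpa using h), List.getD_eq_getElem _ _ (by simpa using h)]
    simp [h1, h2]
  · simp only [encode, literalIndex]
    cases s
    · rw [List.getD_append_right _ _ _ _ (by simp; lia), List.getD_eq_getElem _ _ (by simp; lia)]
      simp only [List.getElem_ofFn, side]
      congr 2
      ext
      simp
      lia
    · rw [List.getD_append _ _ _ _ (by simp; lia), List.getD_append_right _ _ _ _ (by simp; lia),
        List.getD_eq_getElem _ _ (by simp; lia)]
      simp only [List.getElem_ofFn, side]
      congr 2
      ext
      simp
      lia

theorem le_of_mem_encode {x : ℕ} (hx : x ∈ encode G A B) : x ≤ n + 1 := by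
  have (p : Prop) : bit p ≤ n + 1 := by
    rw [bit]
    split_ifs <;> lia
  simp only [encode, List.mem_append, List.mem_singleton, List.mem_ofFn] at hx
  rcases hx with ((rfl | ⟨k, rfl⟩) | ⟨k, rfl⟩) | ⟨k, rfl⟩
  · lia
  all_goals exact this _

end Layout

/-! Expressions for the parts of the input and for the cells of the table. -/

/-- The number of vertices. -/
def sizeExpr : Expr := .load (.lit 0)

/-- The truth value of `x = y`. -/
def eqExpr (x y : Expr) : Expr := .sub (.lit 1) (.add (.sub x y) (.sub y x))

/-- Negation of truth values. -/
def notExpr (x : Expr) : Expr := .sub (.lit 1) x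

/-- The truth value of adjacency. -/
def adjExpr (x y : Expr) : Expr := .load (.add (.lit 1) (.add (.mul x sizeExpr) y))

/-- The number of a literal. -/
def literalExpr (s : Bool) (x : Expr) : Expr := .add (if s then .lit 0 else sizeExpr) x

/-- The truth value of the membership in one of the two given sets. -/
def sideExpr (s : Bool) (x : Expr) : Expr :=
  .load (.add (.add (.lit 1) (.mul sizeExpr sizeExpr)) (literalExpr s x))

/-- The address of the flag. -/
def flagExpr : Expr :=
  .add (.add (.add (.lit 1) (.mul sizeExpr sizeExpr)) sizeExpr) sizeExpr

/-- The address of an implication between two literals. -/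
def cellExpr (x y : Expr) : Expr :=
  .add flagExpr (.add (.lit 1) (.add (.mul x (.add sizeExpr sizeExpr)) y))

/-- The number of the interior literal. -/
def interiorExpr (s : Bool) (b u v : Expr) : Expr :=
  .add (.mul (adjExpr u b) (literalExpr (!s) u)) (.mul (notExpr (adjExpr u b)) (literalExpr s v))

/-- The number of the negation of the interior literal. -/
def negInteriorExpr (s : Bool) (b u v : Expr) : Expr :=
  .add (.mul (adjExpr u b) (literalExpr s u)) (.mul (notExpr (adjExpr u b)) (literalExpr (!s) v))

/-- The truth value of: `a` is on side `s`, `b` on the other side, and they are adjacent. -/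
def linkExpr (s : Bool) (a b : Expr) : Expr :=
  .mul (.mul (sideExpr s a) (sideExpr (!s) b)) (adjExpr a b)

/-! ### Values of the expressions. -/

section Eval

variable {n : ℕ} {G : SimpleGraph (Fin n)} {A B : Set (Fin n)} {m : ℕ → ℕ} {ρ : List ℕ}
  {x y z w : Expr} {u v a b : Fin n} {s : Bool}

theorem bit_ne_zero {p : Prop} : bit p ≠ 0 ↔ p := by
  by_cases h : p <;> simp [bit, h]

/-- Truth is being nonzero, so products are conjunctions and sums are disjunctions. -/
theorem eval_mul_ne_zero :
    (Expr.mul x y).eval ρ m ≠ 0 ↔ x.eval ρ m ≠ 0 ∧ y.eval ρ m ≠ 0 := by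
  simp [Expr.eval]

theorem eval_add_ne_zero :
    (Expr.add x y).eval ρ m ≠ 0 ↔ x.eval ρ m ≠ 0 ∨ y.eval ρ m ≠ 0 := by
  simp only [Expr.eval]
  lia

theorem eval_notExpr_ne_zero : (notExpr x).eval ρ m ≠ 0 ↔ ¬ x.eval ρ m ≠ 0 := by
  simp only [notExpr, Expr.eval]
  lia

theorem eval_eqExpr_ne_zero (hx : x.eval ρ m = u) (hy : y.eval ρ m = v) :
    (eqExpr x y).eval ρ m ≠ 0 ↔ u = v := by
  simp only [eqExpr, Expr.eval, hx, hy, Fin.ext_iff]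
  lia

theorem eval_sizeExpr (hm : HoldsInput G A B m) : sizeExpr.eval ρ m = n := hm.size

theorem eval_adjExpr (hm : HoldsInput G A B m) (hx : x.eval ρ m = u) (hy : y.eval ρ m = v) :
    (adjExpr x y).eval ρ m = bit (G.Adj u v) := by
  simp only [adjExpr, Expr.eval, hx, hy, eval_sizeExpr hm, hm.adj]

theorem eval_adjExpr_ne_zero (hm : HoldsInput G A B m) (hx : x.eval ρ m = u)
    (hy : y.eval ρ m = v) : (adjExpr x y).eval ρ m ≠ 0 ↔ G.Adj u v := by
  rw [eval_adjExpr hm hx hy, bit_ne_zero]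

theorem eval_literalExpr (hm : HoldsInput G A B m) (hx : x.eval ρ m = u) :
    (literalExpr s x).eval ρ m = literalIndex (s, u) := by
  cases s <;> simp [literalExpr, literalIndex, Expr.eval, hx, eval_sizeExpr hm]

theorem eval_sideExpr_ne_zero (hm : HoldsInput G A B m) (hx : x.eval ρ m = u) :
    (sideExpr s x).eval ρ m ≠ 0 ↔ u ∈ side A B s := by
  simp only [sideExpr, Expr.eval, eval_literalExpr hm hx, eval_sizeExpr hm, hm.side]
  exact bit_ne_zero

theorem eval_flagExpr (hm : HoldsInput G A B m) : flagExpr.eval ρ m = flagCell n := by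
  simp only [flagExpr, Expr.eval, eval_sizeExpr hm, flagCell]

theorem eval_cellExpr (hm : HoldsInput G A B m) {p q : Bool × Fin n}
    (hx : x.eval ρ m = literalIndex p) (hy : y.eval ρ m = literalIndex q) :
    (cellExpr x y).eval ρ m = implicationCell p q := by
  simp only [cellExpr, Expr.eval, eval_flagExpr hm, eval_sizeExpr hm, hx, hy, implicationCell]

/-- Adjacency selects one of two numbers by multiplication, which needs its value to be exactly `0`
or `1`. -/
theorem eval_interiorExpr (hm : HoldsInput G A B m) (hx : x.eval ρ m = b) (hy : y.eval ρ m = u)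
    (hz : z.eval ρ m = v) :
    (interiorExpr s x y z).eval ρ m = literalIndex (interiorLiteral G s b u v) := by
  simp only [interiorExpr, notExpr, Expr.eval, eval_adjExpr hm hy hx, eval_literalExpr hm hy,
    eval_literalExpr hm hz, interiorLiteral, bit]
  split_ifs <;> simp

theorem eval_negInteriorExpr (hm : HoldsInput G A B m) (hx : x.eval ρ m = b)
    (hy : y.eval ρ m = u) (hz : z.eval ρ m = v) :
    (negInteriorExpr s x y z).eval ρ m = literalIndex (neg (interiorLiteral G s b u v)) := by
  simp only [negInteriorExpr, notExpr, Expr.eval, eval_adjExpr hm hy hx, eval_literalExpr hm hy,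
    eval_literalExpr hm hz, interiorLiteral, bit]
  split_ifs <;> simp [neg]

theorem eval_linkExpr_ne_zero (hm : HoldsInput G A B m) (hx : x.eval ρ m = a)
    (hy : y.eval ρ m = b) : (linkExpr s x y).eval ρ m ≠ 0 ↔
      (a ∈ side A B s ∧ b ∈ side A B (!s)) ∧ G.Adj a b := by
  rw [linkExpr, eval_mul_ne_zero, eval_mul_ne_zero, eval_sideExpr_ne_zero hm hx,
    eval_sideExpr_ne_zero hm hy, eval_adjExpr_ne_zero hm hx hy]

end Eval

section Loops

variable {n : ℕ} {S : Stmt} {ρ : List ℕ} {Inv : (ℕ → ℕ) → Prop} {e : Expr}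

theorem computes_forBelow_fin {W : Fin n → ℕ → Prop} (he : ∀ m, Inv m → e.eval ρ m = n)
    (hS : ∀ i : Fin n, Computes S (ρ ++ [(i : ℕ)]) Inv (W i)) :
    Computes (.forBelow e S) ρ Inv fun x => ∃ i, W i x :=
  (computes_forBelow (W := fun i x => ∃ h : i < n, W ⟨i, h⟩ x) he fun i hi =>
    (hS ⟨i, hi⟩).congr fun _ => ⟨fun h => ⟨hi, h⟩, fun ⟨_, h⟩ => h⟩).congr fun _ =>
    ⟨fun ⟨i, _, hi, h⟩ => ⟨⟨i, hi⟩, h⟩, fun ⟨i, h⟩ => ⟨i, i.2, i.2, h⟩⟩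

theorem computes_forBelow_literal {W : Bool × Fin n → ℕ → Prop}
    (he : ∀ m, Inv m → e.eval ρ m = n + n)
    (hS : ∀ p : Bool × Fin n, Computes S (ρ ++ [literalIndex p]) Inv (W p)) :
    Computes (.forBelow e S) ρ Inv fun x => ∃ p, W p x := by
  refine (computes_forBelow (W := fun i x => ∃ p : Bool × Fin n, literalIndex p = i ∧ W p x) he
    fun i hi => ?_).congr fun _ => ⟨fun ⟨_, _, p, _, h⟩ => ⟨p, h⟩,
      fun ⟨p, h⟩ => ⟨_, literalIndex_lt p, p, rfl, h⟩⟩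
  obtain ⟨p, rfl⟩ := exists_literalIndex_eq hi
  exact (hS p).congr fun _ => ⟨fun h => ⟨p, rfl, h⟩,
    fun ⟨q, hq, h⟩ => literalIndex_injective hq ▸ h⟩

end Loops

/-! ### The statements of the program. -/

/-- Write the implications whose first side is `s` into the table. -/
def implicationStmt (s : Bool) : Stmt :=
  .forBelow sizeExpr (.seq
    (.put (sideExpr s (.var 0)) (cellExpr (literalExpr (!s) (.var 0)) (literalExpr s (.var 0))))
    (.forBelow sizeExpr (.forBelow sizeExpr (.forBelow sizeExpr (.seq
      (.put
        (.mul (linkExpr s (.var 0) (.var 1)) (.mul (adjExpr (.var 2) (.var 3)) (notExpr (.mul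
          (.add (eqExpr (.var 2) (.var 0)) (adjExpr (.var 0) (.var 2)))
          (.add (eqExpr (.var 3) (.var 1)) (adjExpr (.var 1) (.var 3)))))))
        (cellExpr (literalExpr s (.var 2)) (literalExpr s (.var 3))))
      (.forBelow sizeExpr (.forBelow sizeExpr (.put
        (.mul (linkExpr s (.var 0) (.var 1)) (.mul (adjExpr (.var 0) (.var 2))
          (.mul (adjExpr (.var 0) (.var 4)) (.mul (notExpr (eqExpr (.var 2) (.var 1)))
          (.mul (notExpr (eqExpr (.var 4) (.var 1))) (.mul (notExpr (eqExpr (.var 2) (.var 4)))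
          (.mul (notExpr (adjExpr (.var 2) (.var 4))) (.mul (adjExpr (.var 2) (.var 3))
            (adjExpr (.var 4) (.var 5))))))))))
        (cellExpr (negInteriorExpr s (.var 1) (.var 2) (.var 3))
          (interiorExpr s (.var 1) (.var 4) (.var 5)))))))))))

/-- Close the table under composition with the literal in variable `0`. -/
def composeStmt : Stmt :=
  .forBelow (.add sizeExpr sizeExpr) (.forBelow (.add sizeExpr sizeExpr) (.put
    (.mul (.load (cellExpr (.var 1) (.var 0))) (.load (cellExpr (.var 0) (.var 2))))
    (cellExpr (.var 1) (.var 2))))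

/-- Set the flag if some literal is equivalent to its negation. -/
def contradictionStmt : Stmt :=
  .forBelow sizeExpr (.put
    (.mul (.load (cellExpr (literalExpr true (.var 0)) (literalExpr false (.var 0))))
      (.load (cellExpr (literalExpr false (.var 0)) (literalExpr true (.var 0)))))
    flagExpr)

/-- Build the table of implications, close it under composition, and set the flag if the
implications are contradictory. -/
def separationStmt : Stmt :=
  .seq (.seq (implicationStmt true) (implicationStmt false))
    (.seq (.forBelow (.add sizeExpr sizeExpr) composeStmt) contradictionStmt)

/-! ### Correctness of the program. -/

section Correctness

variable {n : ℕ} {G : SimpleGraph (Fin n)} {A B : Set (Fin n)}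

theorem HoldsInput.update_implicationCell {m : ℕ → ℕ} (h : HoldsInput G A B m)
    (p q : Bool × Fin n) : HoldsInput G A B (Function.update m (implicationCell p q) 1) :=
  h.update (flagCell_lt_implicationCell p q).le 1

theorem computes_implicationStmt (s : Bool) :
    Computes (implicationStmt s) [] (HoldsInput G A B) fun x => ∃ p q, x = implicationCell p q ∧
      ((∃ a ∈ side A B s, p = (!s, a) ∧ q = (s, a)) ∨
        ∃ a b, a ∈ side A B s ∧ b ∈ side A B (!s) ∧ G.Adj a b ∧ EdgeImplies G s a b p q) := by
  have hN : ∀ ρ m, HoldsInput G A B m → sizeExpr.eval ρ m = n := fun _ _ h => eval_sizeExpr h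
  have hU : ∀ (p q : Bool × Fin n) (P : Prop), P → ∀ m, HoldsInput G A B m →
    HoldsInput G A B (Function.update m (implicationCell p q) 1) :=
    fun p q _ _ m hm => hm.update_implicationCell p q
  refine (computes_forBelow_fin (hN _) fun a => (computes_put (p := a ∈ side A B s)
    (a := implicationCell (!s, a) (s, a)) (fun m hm => eval_sideExpr_ne_zero hm rfl)
    (fun m hm _ => eval_cellExpr hm (eval_literalExpr hm rfl) (eval_literalExpr hm rfl))
    (hU _ _ _)).seq (computes_forBelow_fin (hN _) fun b => computes_forBelow_fin (hN _) fun u =>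
    computes_forBelow_fin (hN _) fun v => (computes_put
      (p := ((a ∈ side A B s ∧ b ∈ side A B (!s)) ∧ G.Adj a b) ∧ G.Adj u v ∧
        ¬ ((u = a ∨ G.Adj a u) ∧ (v = b ∨ G.Adj b v)))
      (a := implicationCell (s, u) (s, v)) ?_ (fun m hm _ => ?_) (hU _ _ _)).seq
      (computes_forBelow_fin (hN _) fun u' =>
      computes_forBelow_fin (hN _) fun v' => computes_put
      (p := ((a ∈ side A B s ∧ b ∈ side A B (!s)) ∧ G.Adj a b) ∧ G.Adj a u ∧ G.Adj a u' ∧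
        ¬ u = b ∧ ¬ u' = b ∧ ¬ u = u' ∧ ¬ G.Adj u u' ∧ G.Adj u v ∧ G.Adj u' v')
      (a := implicationCell (neg (interiorLiteral G s b u v)) (interiorLiteral G s b u' v')) ?_
      (fun m hm _ => ?_) (hU _ _ _)))).congr fun x => ?_
  · intro m hm
    simp only [eval_mul_ne_zero, eval_notExpr_ne_zero, eval_add_ne_zero]
    rw [eval_linkExpr_ne_zero hm (a := a) (b := b) rfl rfl,
      eval_adjExpr_ne_zero hm (u := u) (v := v) rfl rfl,
      eval_adjExpr_ne_zero hm (u := a) (v := u) rfl rfl,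
      eval_adjExpr_ne_zero hm (u := b) (v := v) rfl rfl,
      eval_eqExpr_ne_zero (u := u) (v := a) rfl rfl,
      eval_eqExpr_ne_zero (u := v) (v := b) rfl rfl]
  · exact eval_cellExpr hm (eval_literalExpr (u := u) hm rfl) (eval_literalExpr (u := v) hm rfl)
  · intro m hm
    simp only [eval_mul_ne_zero, eval_notExpr_ne_zero]
    rw [eval_linkExpr_ne_zero hm (a := a) (b := b) rfl rfl,
      eval_adjExpr_ne_zero hm (u := a) (v := u) rfl rfl,
      eval_adjExpr_ne_zero hm (u := a) (v := u') rfl rfl,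
      eval_eqExpr_ne_zero (u := u) (v := b) rfl rfl, eval_eqExpr_ne_zero (u := u') (v := b) rfl rfl,
      eval_eqExpr_ne_zero (u := u) (v := u') rfl rfl,
      eval_adjExpr_ne_zero hm (u := u) (v := u') rfl rfl,
      eval_adjExpr_ne_zero hm (u := u) (v := v) rfl rfl,
      eval_adjExpr_ne_zero hm (u := u') (v := v') rfl rfl]
  · exact eval_cellExpr hm (eval_negInteriorExpr (b := b) (u := u) (v := v) hm rfl rfl rfl)
      (eval_interiorExpr (b := b) (u := u') (v := v') hm rfl rfl rfl)
  · constructor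
    · rintro ⟨a, ⟨ha, rfl⟩ | ⟨b, u, v, ⟨⟨⟨⟨ha, hb⟩, hab⟩, huv, h⟩, rfl⟩ |
        ⟨u', v', ⟨⟨⟨ha, hb⟩, hab⟩, h1, h2, h3, h4, h5, h6, h7, h8⟩, rfl⟩⟩⟩
      · exact ⟨_, _, rfl, .inl ⟨a, ha, rfl, rfl⟩⟩
      · exact ⟨_, _, rfl, .inr ⟨a, b, ha, hb, hab, .cut u v huv h⟩⟩
      · exact ⟨_, _, rfl, .inr ⟨a, b, ha, hb, hab, .clique u v u' v' h1 h2 h3 h4 h5 h6 h7 h8⟩⟩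
    · rintro ⟨p, q, rfl, ⟨a, ha, rfl, rfl⟩ | ⟨a, b, ha, hb, hab, h⟩⟩
      · exact ⟨a, .inl ⟨ha, rfl⟩⟩
      · refine ⟨a, .inr ⟨b, ?_⟩⟩
        cases h with
        | cut u v huv h => exact ⟨u, v, .inl ⟨⟨⟨⟨ha, hb⟩, hab⟩, huv, h⟩, rfl⟩⟩
        | clique u v u' v' h1 h2 h3 h4 h5 h6 h7 h8 =>
          exact ⟨u, v, .inr ⟨u', v', ⟨⟨⟨ha, hb⟩, hab⟩, h1, h2, h3, h4, h5, h6, h7, h8⟩, rfl⟩⟩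

theorem computes_implicationStmt_both :
    Computes (.seq (implicationStmt true) (implicationStmt false)) [] (HoldsInput G A B)
      fun x => ∃ p q, x = implicationCell p q ∧ Implies G A B p q := by
  refine ((computes_implicationStmt true).seq (computes_implicationStmt false)).congr fun x => ?_
  have key : ∀ p q, Implies G A B p q ↔ ∃ s, (∃ a ∈ side A B s, p = (!s, a) ∧ q = (s, a)) ∨
      ∃ a b, a ∈ side A B s ∧ b ∈ side A B (!s) ∧ G.Adj a b ∧ EdgeImplies G s a b p q := by
    intro p q
    constructor
    · rintro (⟨s, a, h⟩ | ⟨s, a, b, _, _, ha, hb, hab, h⟩)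
      · exact ⟨s, .inl ⟨a, h, rfl, rfl⟩⟩
      · exact ⟨s, .inr ⟨a, b, ha, hb, hab, h⟩⟩
    · rintro ⟨s, ⟨a, h, rfl, rfl⟩ | ⟨a, b, ha, hb, hab, h⟩⟩
      · exact .unit s a h
      · exact .edge s a b p q ha hb hab h
  simp only [key, Bool.exists_bool]
  constructor
  · rintro (⟨p, q, hx, h⟩ | ⟨p, q, hx, h⟩)
    · exact ⟨p, q, hx, .inr h⟩
    · exact ⟨p, q, hx, .inl h⟩
  · rintro ⟨p, q, hx, h | h⟩
    · exact .inr ⟨p, q, hx, h⟩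
    · exact .inl ⟨p, q, hx, h⟩

/-- The entry of the table for two literals. -/
def Entry (m : ℕ → ℕ) (p q : Bool × Fin n) : Prop := m (implicationCell p q) ≠ 0

theorem entry_update {m : ℕ → ℕ} {p q p' q' : Bool × Fin n} :
    Entry (Function.update m (implicationCell p q) 1) p' q' ↔
      Entry m p' q' ∨ (p' = p ∧ q' = q) := by
  by_cases h : p' = p ∧ q' = q
  · obtain ⟨rfl, rfl⟩ := h
    simp [Entry]
  · simp [Entry, Function.update_of_ne (mt implicationCell_inj.1 h), h]

/-- Updating in place is harmless: composing through `r` creates no new entry into or out of `r`, so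
every test has the same answer as in the initial table. The invariant in `key` keeps the table
between the initial one and the intended one. -/
theorem composeStmt_run (r : Bool × Fin n) {m : ℕ → ℕ} (hm : HoldsInput G A B m) :
    HoldsInput G A B (composeStmt.run [literalIndex r] m) ∧
      (composeStmt.run [literalIndex r] m (flagCell n) ≠ 0 ↔ m (flagCell n) ≠ 0) ∧
      ∀ p q : Bool × Fin n, Entry (composeStmt.run [literalIndex r] m) p q ↔
        Entry m p q ∨ (Entry m p r ∧ Entry m r q) := by
  have hN : ∀ ρ m, HoldsInput G A B m → (Expr.add sizeExpr sizeExpr).eval ρ m = n + n :=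
    fun _ _ h => by simp only [Expr.eval, eval_sizeExpr h]
  have key : Computes composeStmt [literalIndex r] (fun m' => HoldsInput G A B m' ∧
      ∀ p q : Bool × Fin n, (Entry m p q → Entry m' p q) ∧
        (Entry m' p q → Entry m p q ∨ (Entry m p r ∧ Entry m r q)))
      (fun x => ∃ p q : Bool × Fin n, (Entry m p r ∧ Entry m r q) ∧ x = implicationCell p q) := by
    refine computes_forBelow_literal (fun _ h => hN _ _ h.1) fun p =>
      computes_forBelow_literal (fun _ h => hN _ _ h.1) fun q => computes_put ?_ ?_ ?_
    · rintro m' ⟨h, h'⟩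
      rw [eval_mul_ne_zero]
      simp only [Expr.eval]
      rw [eval_cellExpr h (p := p) (q := r) rfl rfl, eval_cellExpr h (p := r) (q := q) rfl rfl]
      change Entry m' p r ∧ Entry m' r q ↔ _
      have h1 := h' p r
      have h2 := h' r q
      tauto
    · exact fun m' h _ => eval_cellExpr h.1 rfl rfl
    · rintro hpq m' ⟨h, h'⟩
      refine ⟨h.update_implicationCell p q, fun p' q' => ?_⟩
      rw [entry_update]
      refine ⟨fun h => .inl ((h' p' q').1 h), ?_⟩
      rintro (h | ⟨rfl, rfl⟩)
      · exact (h' p' q').2 h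
      · exact .inr hpq
  obtain ⟨⟨h1, -⟩, h2⟩ := key m ⟨hm, fun p q => ⟨id, .inl⟩⟩
  refine ⟨h1, ?_, fun p q => ?_⟩
  · rw [h2]
    refine or_iff_left ?_
    rintro ⟨p, q, -, h⟩
    exact (flagCell_lt_implicationCell p q).ne h
  · rw [Entry, h2]
    refine or_congr_right ⟨?_, fun h => ⟨p, q, h, rfl⟩⟩
    rintro ⟨p', q', h, heq⟩
    obtain ⟨rfl, rfl⟩ := implicationCell_inj.1 heq
    exact h

/-- Warshall's algorithm. With `N` rounds left, the table is closed under composition through all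
literals numbered `N` or higher; at the end it is transitive, contains the initial table and lies in
its transitive closure. -/
theorem forBelow_composeStmt_run {m : ℕ → ℕ} (hm : HoldsInput G A B m) (m' : ℕ → ℕ)
    (hm' : m' = (Stmt.forBelow (.add sizeExpr sizeExpr) composeStmt).run [] m) :
    HoldsInput G A B m' ∧ (m' (flagCell n) ≠ 0 ↔ m (flagCell n) ≠ 0) ∧
      ∀ p q : Bool × Fin n, Entry m' p q ↔ TransGen (Entry m) p q := by
  have key : ∀ N ≤ n + n, ∀ m, HoldsInput G A B m →
      (∀ r : Bool × Fin n, N ≤ literalIndex r → ∀ p q, Entry m p r → Entry m r q → Entry m p q) →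
      ∀ m', m' = iterateDown (fun i => composeStmt.run ([] ++ [i])) N m →
      HoldsInput G A B m' ∧ (m' (flagCell n) ≠ 0 ↔ m (flagCell n) ≠ 0) ∧
      (∀ p q r : Bool × Fin n, Entry m' p r → Entry m' r q → Entry m' p q) ∧
      ∀ p q : Bool × Fin n, (Entry m p q → Entry m' p q) ∧
        (Entry m' p q → TransGen (Entry m) p q) := by
    intro N
    induction N with
    | zero =>
      rintro - m hm hc m' rfl
      exact ⟨hm, Iff.rfl, fun p q r => hc r (Nat.zero_le _) p q, fun p q => ⟨id, .single⟩⟩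
    | succ N ih =>
      intro hN m hm hc m' hm'
      obtain ⟨r, hr⟩ := exists_literalIndex_eq (show N < n + n by lia)
      obtain ⟨h1, h2, h3⟩ := composeStmt_run r hm
      rw [iterateDown, List.nil_append, ← hr] at hm'
      -- Closure through an earlier literal `r'` survives the round for `r`: a new entry at `r'` is
      -- a detour through `r`, and the old closure through `r'` supplies the entries from `p` to `r`
      -- and from `r` to `q`.
      obtain ⟨h4, h5, h6, h7⟩ := ih (by lia) _ h1 (fun r' hr' p q hp hq => by
        rw [h3] at hp hq ⊢
        by_cases h : r' = r
        · subst h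
          tauto
        · have : N ≠ literalIndex r' := fun h' => h (literalIndex_injective (by rw [hr, h']))
          have hc' := hc r' (by lia)
          have h1 := hc' p q
          have h2 := hc' p r
          have h3 := hc' r q
          tauto) m' (hr ▸ hm')
      refine ⟨h4, h5.trans h2, h6, fun p q => ⟨fun h => (h7 p q).1 ((h3 p q).2 (.inl h)),
        fun h => ?_⟩⟩
      have lift : ∀ p q, TransGen (Entry (composeStmt.run [literalIndex r] m)) p q →
          TransGen (Entry m) p q := fun p q h => by
        have step : ∀ p q : Bool × Fin n, Entry (composeStmt.run [literalIndex r] m) p q →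
            TransGen (Entry m) p q := fun p q h => by
          rcases (h3 p q).1 h with h | ⟨h, h'⟩
          · exact .single h
          · exact .tail (.single h) h'
        induction h with
        | single h => exact step _ _ h
        | tail _ h ih => exact ih.trans (step _ _ h)
      exact lift p q ((h7 p q).2 h)
  rw [Stmt.run, show (Expr.add sizeExpr sizeExpr).eval [] m = n + n by
    simp only [Expr.eval, eval_sizeExpr hm]] at hm'
  obtain ⟨h1, h2, h3, h4⟩ := key (n + n) le_rfl m hm
    (fun r hr => absurd (literalIndex_lt r) (by lia)) m' hm'
  refine ⟨h1, h2, fun p q => ⟨(h4 p q).2, fun h => ?_⟩⟩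
  induction h with
  | single h => exact (h4 _ _).1 h
  | tail _ h ih => exact h3 _ _ _ ih ((h4 _ _).1 h)

theorem contradictionStmt_run {m : ℕ → ℕ} (hm : HoldsInput G A B m) :
    HoldsInput G A B (contradictionStmt.run [] m) ∧
      (contradictionStmt.run [] m (flagCell n) ≠ 0 ↔ m (flagCell n) ≠ 0 ∨
        ∃ p : Bool × Fin n, Entry m p (neg p) ∧ Entry m (neg p) p) := by
  have key : Computes contradictionStmt [] (fun m' => HoldsInput G A B m' ∧
      ∀ p q : Bool × Fin n, Entry m' p q ↔ Entry m p q)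
      (fun x => ∃ v : Fin n, (Entry m (true, v) (false, v) ∧ Entry m (false, v) (true, v)) ∧
        x = flagCell n) := by
    refine computes_forBelow_fin (fun _ h => eval_sizeExpr h.1) fun v => computes_put ?_
      (fun m' h _ => eval_flagExpr h.1) ?_
    · rintro m' ⟨h, h'⟩
      rw [eval_mul_ne_zero]
      simp only [Expr.eval]
      rw [eval_cellExpr h (eval_literalExpr (u := v) h rfl) (eval_literalExpr (u := v) h rfl),
        eval_cellExpr h (eval_literalExpr (u := v) h rfl) (eval_literalExpr (u := v) h rfl),
        ← h', ← h']
      rfl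
    · rintro - m' ⟨h, h'⟩
      refine ⟨h.update le_rfl 1, fun p q => ?_⟩
      rw [← h', Entry, Function.update_of_ne (flagCell_lt_implicationCell p q).ne']
      rfl
  obtain ⟨⟨h, -⟩, h'⟩ := key m ⟨hm, fun _ _ => Iff.rfl⟩
  refine ⟨h, (h' _).trans (or_congr_right ⟨fun ⟨v, h, _⟩ => ⟨(true, v), h⟩, ?_⟩)⟩
  rintro ⟨⟨_ | _, v⟩, h1, h2⟩
  · exact ⟨v, ⟨h2, h1⟩, rfl⟩
  · exact ⟨v, ⟨h1, h2⟩, rfl⟩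

theorem separationStmt_run (hG : G.Connected) (hAB : Linked G A B) :
    (Expr.sub (.lit 1) (.load flagExpr)).eval []
      (separationStmt.run [] fun i => (encode G A B).getD i 0) = bit (Separable G A B) := by
  -- Cells beyond the input hold the default value zero, so the table and the flag start empty.
  have h0 : ∀ x, flagCell n ≤ x → ¬ (encode G A B).getD x 0 ≠ 0 := fun x hx => by
    rw [List.getD_eq_default _ _ (by rwa [length_encode])]
    simp
  rw [separationStmt, Stmt.run, Stmt.run]
  obtain ⟨h1, h2⟩ := computes_implicationStmt_both _ (holdsInput_encode (G := G) (A := A) (B := B))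
  generalize (Stmt.seq (implicationStmt true) (implicationStmt false)).run [] _ = m₁ at h1 h2
  have hF : ¬ m₁ (flagCell n) ≠ 0 := by
    rw [h2]
    rintro (h | ⟨p, q, h, -⟩)
    · exact h0 _ le_rfl h
    · exact (flagCell_lt_implicationCell p q).ne h
  have hE : Entry m₁ = Implies G A B := by
    ext p q
    rw [Entry, h2, or_iff_right (h0 _ (flagCell_lt_implicationCell p q).le)]
    refine ⟨?_, fun h => ⟨p, q, rfl, h⟩⟩
    rintro ⟨p', q', heq, h⟩
    obtain ⟨rfl, rfl⟩ := implicationCell_inj.1 heq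
    exact h
  obtain ⟨h3, h4, h5⟩ := forBelow_composeStmt_run h1 _ rfl
  obtain ⟨h6, h7⟩ := contradictionStmt_run h3
  rw [or_iff_right (fun h => hF (h4.1 h))] at h7
  simp only [h5, hE] at h7
  simp only [Expr.eval, eval_flagExpr h6]
  -- The flag is nonzero exactly for contradictory implications, and truncated subtraction from `1`
  -- turns this into the answer.
  rw [bit, separable_iff hG hAB, exists_forall_isTrue_iff fun p q => Implies.contraposition, ← h7]
  split_ifs <;> lia

end Correctness

end Monophonic

theorem mainTheorem4 :
    ∃ (P : RAM.Program) (p : Polynomial ℕ),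
      ∀ (n : ℕ) (G : SimpleGraph (Fin n)) (A B : Set (Fin n)),
        G.Connected → Disjoint A B → Monophonic.Linked G A B → Monophonic.Saturated G A B →
          (Monophonic.Separable G A B →
            RAM.OutputsWithin P (RAM.encode G A B) (p.eval n) 1) ∧
          (¬ Monophonic.Separable G A B →
            RAM.OutputsWithin P (RAM.encode G A B) (p.eval n) 0) := by
  obtain ⟨P, p, h⟩ := RAM.exists_outputsWithin Monophonic.separationStmt
    (.sub (.lit 1) (.load Monophonic.flagExpr))
  refine ⟨P, p, fun n G A B hG _ hAB _ => ?_⟩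
  have key := h n (RAM.encode G A B) fun _ => Monophonic.le_of_mem_encode
  rw [Monophonic.separationStmt_run hG hAB] at key
  exact ⟨fun hs => by rwa [RAM.bit, if_pos hs] at key, fun hs => by rwa [RAM.bit, if_neg hs] at key⟩
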